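/- Let $k\ge 0$ and $N\ge 2k$ be integers. Let $P_k(N)$ be the partition algebra over $\mathbb{C}$: it has as basis the diagrams $d_\pi$ of the set partitions $\pi$ of $\{1,\dots,k,1',\dots,k'\}$, and $d_\pi d_{\pi'}=N^{c}d_{\pi''}$, where $\pi''$ is obtained by placing $\pi$ above $\pi'$, identifying the unprimed (bottom) points of $\pi$ with the primed (top) points of $\pi'$, and removing the $c$ components that lie entirely in the middle row. Let $d\mapsto d^T$ be the linear map that exchanges primed and unprimed points. Let $V_N=\mathbb{C}^N$ be the defining representation of $S_N$; $P_k(N)$ acts on $V_N^{\otimes k}$, commuting with $S_N$, by $d_\pi\mapsto D_\pi$, where $(D_\pi)^{i_{1'}\dots i_{k'}}_{i_1\dots i_k}=1$ if $i_a=i_b$ whenever $a,b$ lie in the same block of $\pi$, and $0$ otherwise. Write $D$ for the linear map on $V_N^{\otimes k}$ given by $d\in P_k(N)$, and put $\langle d,d'\rangle=\mathrm{Tr}_{V_N^{\otimes k}}(D\,(D')^T)$. Let $\Lambda_{k,N}$ be the set of partitions $\lambda\vdash N$ with at most $k$ boxes below the first row, let $V_\lambda$ be the irreducible representation of $S_N$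 labelled by $\lambda$, and let $Z_\lambda=\mathrm{Hom}_{S_N}(V_\lambda,V_N^{\otimes k})$, on which $P_k(N)$ acts by composition. Choose bases $(E^\lambda_a)$ of $V_\lambda$ and $(E^\lambda_\alpha)$ of $Z_\lambda$ such that the Clebsch–Gordan coefficients $(C^\lambda_{a,\alpha})^{i_1\dots i_k}$, the components of $E^\lambda_\alpha(E^\lambda_a)\in V_N^{\otimes k}$ in the basis $e_{i_1}\otimes\dots\otimes e_{i_k}$, are real and for each $\lambda$ orthonormal, $\sum_{i_1,\dots,i_k}(C^\lambda_{a,\alpha})^{i_1\dots i_k}(C^\lambda_{b,\beta})^{i_1\dots i_k}=\delta_{ab}\delta_{\alpha\beta}$. Let $D^\lambda(d)$ be the matrix of $d\in P_k(N)$ on $Z_\lambda$, so that $dE^\lambda_\beta=\sum_\alpha D^\lambda_{\alpha\beta}(d)E^\lambda_\alpha$. Let $(b_i)$ be any basis of $P_k(N)$, with corresponding linear maps $B_i$, let $g_{ij}=\mathrm{Tr}_{V_N^{\otimes k}}(B_iB_j)$, $b_i^\dagger=\sum_j(g^{-1})_{ji}b_j^T$, and $$Q^\lambda_{\alpha\beta}=\sum_i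 \dim V_\lambda\; D^\lambda_{\alpha\beta}(b_i^\dagger)\,b_i .$$ Then: 1. The form $\langle\cdot,\cdot\rangle$ is non-degenerate, $\langle b_i,b_j^\dagger\rangle=\delta_{ij}$, $Z_\lambda\neq0$ for all $\lambda\in\Lambda_{k,N}$, and bases $(E^\lambda_a)$, $(E^\lambda_\alpha)$ as above exist. 2. For every choice of such bases, the elements $Q^\lambda_{\alpha\beta}$ ($\lambda\in\Lambda_{k,N}$, $1\le\alpha,\beta\le\dim Z_\lambda$) form a basis of $P_k(N)$, and $$Q^\lambda_{\alpha\beta}Q^{\lambda'}_{\alpha'\beta'}=\delta^{\lambda\lambda'}\delta_{\beta\alpha'}Q^\lambda_{\alpha\beta'} .$$ 3. The map $d\mapsto(D^\lambda(d))_{\lambda\in\Lambda_{k,N}}$ is an isomorphism of algebras from $P_k(N)$ onto $\prod_{\lambda\in\Lambda_{k,N}}\mathrm{Mat}_{\dim Z_\lambda}(\mathbb{C})$ (an Artin–Wedderburn decomposition), under which $Q^\lambda_{\alpha\beta}$ corresponds to the elementary matrix $E_{\alpha\beta}$ in the block $\lambda$. -/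

import Mathlib

namespace PartAlg

/-! ### Set partitions of `{1,…,k,1',…,k'}` and diagram concatenation -/

/-- Set partitions of `{1,…,k,1',…,k'}`, as equivalence relations.  `Sum.inl a` is the unprimed
element `a` (bottom row of a diagram), `Sum.inr a` is the primed element `a'` (top row). -/
abbrev SetPart (k : ℕ) : Type := Setoid (Fin k ⊕ Fin k)

/-- The embedding of the vertices of the upper diagram in the three rows obtained by stacking two
diagrams.  In `(Fin k ⊕ Fin k) ⊕ Fin k` the left summand holds the outer rows
(bottom and top), the right summand is the middle row. -/
def upper {k : ℕ} : Fin k ⊕ Fin k → (Fin k ⊕ Fin k) ⊕ Fin k :=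
  Sum.elim Sum.inr (fun a => Sum.inl (Sum.inr a))

/-- The embedding of the vertices of the lower diagram in the three rows. -/
def lower {k : ℕ} : Fin k ⊕ Fin k → (Fin k ⊕ Fin k) ⊕ Fin k :=
  Sum.elim (fun a => Sum.inl (Sum.inl a)) Sum.inr

/-- Connected components of the graph obtained by placing `π` above `π'` and identifying the bottom
vertices of `π` with the top vertices of `π'`. -/
def stack {k : ℕ} (π π' : SetPart k) : Setoid ((Fin k ⊕ Fin k) ⊕ Fin k) :=
  Setoid.map π upper ⊔ Setoid.map π' lower

/-- The set partition obtained by concatenation: `π` above, `π'` below. -/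
def comp {k : ℕ} (π π' : SetPart k) : SetPart k :=
  Setoid.comap Sum.inl (stack π π')

/-- The components of the stacked diagram that lie entirely in the middle row. -/
def MidBlock {k : ℕ} (π π' : SetPart k) : Type :=
  {q : Quotient (stack π π') // ∀ a : Fin k ⊕ Fin k, Quotient.mk _ (Sum.inl a) ≠ q}

/-- The number of components that are removed from the middle row. -/
noncomputable def loops {k : ℕ} (π π' : SetPart k) : ℕ := Nat.card (MidBlock π π')

/-- The set partition `11'|22'|…|kk'`. -/
def idPart (k : ℕ) : SetPart k := Setoid.ker (Sum.elim id id)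

/-- Exchange primed and unprimed elements. -/
def flip {k : ℕ} (π : SetPart k) : SetPart k := Setoid.comap Sum.swap π

/-! ### The linear maps `D_π` on `V_N^{⊗k}` -/

open Classical in
/-- The matrix `(D_π)^{i_{1'} … i_{k'}}_{i_1 … i_k}`, row index `i'`, column index `i`: it is `1` if
`i_a = i_b` whenever `a`, `b` are in the same block of `π`, and `0` otherwise. -/
noncomputable def diagMatrix {k : ℕ} (R : Type*) [CommSemiring R] (N : ℕ) (π : SetPart k) :
    Matrix (Fin k → Fin N) (Fin k → Fin N) R :=
  fun i' i => if ∀ a b, π a b → Sum.elim i i' a = Sum.elim i i' b then 1 else 0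

theorem stack_le_ker {k N : ℕ} (π π' : SetPart k) (o : Fin k ⊕ Fin k → Fin N) (j : Fin k → Fin N) :
    stack π π' ≤ Setoid.ker (Sum.elim o j) ↔
      (∀ a b, π a b → Sum.elim j (fun x => o (Sum.inr x)) a
        = Sum.elim j (fun x => o (Sum.inr x)) b) ∧
      (∀ a b, π' a b → Sum.elim (fun x => o (Sum.inl x)) j a
        = Sum.elim (fun x => o (Sum.inl x)) j b) := by
  have hu : ∀ a : Fin k ⊕ Fin k, Sum.elim o j (upper a) = Sum.elim j (fun x => o (Sum.inr x)) a := by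
    rintro (a | a) <;> rfl
  have hl : ∀ a : Fin k ⊕ Fin k, Sum.elim o j (lower a) = Sum.elim (fun x => o (Sum.inl x)) j a := by
    rintro (a | a) <;> rfl
  have key : ∀ (ρ : SetPart k) (f : Fin k ⊕ Fin k → (Fin k ⊕ Fin k) ⊕ Fin k),
      Setoid.map ρ f ≤ Setoid.ker (Sum.elim o j) ↔
        ∀ a b, ρ a b → Sum.elim o j (f a) = Sum.elim o j (f b) := by
    intro ρ f
    constructor
    · intro h a b hab
      exact h (Relation.EqvGen.rel _ _ ⟨a, b, hab, rfl, rfl⟩)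
    · intro h
      refine Setoid.eqvGen_le ?_
      rintro _ _ ⟨a, b, hab, rfl, rfl⟩
      exact h a b hab
  rw [stack, sup_le_iff, key, key]
  simp only [hu, hl]

open Classical in
/-- Number of middle labels compatible with given outer labels. -/
theorem card_middle {k N : ℕ} (π π' : SetPart k) (o : Fin k ⊕ Fin k → Fin N)
    (ho : ∀ a b, comp π π' a b → o a = o b) :
    Nat.card {j : Fin k → Fin N // stack π π' ≤ Setoid.ker (Sum.elim o j)}
      = N ^ loops π π' := by
  have : Finite (MidBlock π π') := by unfold MidBlock; infer_instance
  have e : {j : Fin k → Fin N // stack π π' ≤ Setoid.ker (Sum.elim o j)}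
      ≃ (MidBlock π π' → Fin N) :=
    { toFun := fun j q => Quotient.lift (s := stack π π') (Sum.elim o j.1)
        (fun _ _ h => j.2 h) q.1
      invFun := fun g =>
        ⟨fun m => if h : ∃ a : Fin k ⊕ Fin k,
            (Quotient.mk (stack π π') (Sum.inl a)) = Quotient.mk _ (Sum.inr m)
          then o h.choose else g ⟨Quotient.mk _ (Sum.inr m), fun a ha => h ⟨a, ha⟩⟩, by
          have H : ∀ x : (Fin k ⊕ Fin k) ⊕ Fin k,
              Sum.elim o (fun m => if h : ∃ a : Fin k ⊕ Fin k,
                (Quotient.mk (stack π π') (Sum.inl a)) = Quotient.mk _ (Sum.inr m)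
              then o h.choose else g ⟨Quotient.mk _ (Sum.inr m), fun a ha => h ⟨a, ha⟩⟩) x
              = (fun q : Quotient (stack π π') => if h : ∃ a : Fin k ⊕ Fin k,
                (Quotient.mk (stack π π') (Sum.inl a)) = q
                then o h.choose else g ⟨q, fun a ha => h ⟨a, ha⟩⟩) (Quotient.mk _ x) := by
            rintro (a | m)
            · have h : ∃ a' : Fin k ⊕ Fin k, (Quotient.mk (stack π π') (Sum.inl a'))
                  = Quotient.mk _ (Sum.inl a) := ⟨a, rfl⟩
              simp only [Sum.elim_inl, dif_pos h]
              exact (ho _ _ (Quotient.exact (s := stack π π') h.choose_spec)).symm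
            · rfl
          intro x y hxy
          change Sum.elim o _ x = Sum.elim o _ y
          rw [H x, H y, Quotient.sound hxy]⟩
      left_inv := by
        rintro ⟨j, hj⟩
        ext1
        funext m
        by_cases h : ∃ a : Fin k ⊕ Fin k,
            (Quotient.mk (stack π π') (Sum.inl a)) = Quotient.mk _ (Sum.inr m)
        · simp only [dif_pos h]
          exact hj (Quotient.exact (s := stack π π') h.choose_spec)
        · simp only [dif_neg h]
          rfl
      right_inv := by
        intro g
        funext ⟨q, hq⟩
        induction q using Quotient.inductionOn with
        | h x =>
          rcases x with a | m
          · exact absurd rfl (hq a)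
          · have h : ¬ ∃ a : Fin k ⊕ Fin k,
              (Quotient.mk (stack π π') (Sum.inl a)) = Quotient.mk _ (Sum.inr m) :=
              fun ⟨a, ha⟩ => hq a ha
            simp only [Quotient.lift_mk, Sum.elim_inr, dif_neg h] }
  rw [Nat.card_congr e, Nat.card_fun, Nat.card_fin]
  rfl

/-- Diagram concatenation is matrix multiplication of the `D_π`. -/
theorem diagMatrix_mul {k : ℕ} (R : Type*) [CommSemiring R] (N : ℕ) (π π' : SetPart k) :
    diagMatrix R N π * diagMatrix R N π'
      = (N : R) ^ loops π π' • diagMatrix R N (comp π π') := by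
  classical
  ext i' i
  rw [Matrix.mul_apply, Matrix.smul_apply, smul_eq_mul]
  have h1 : ∀ j : Fin k → Fin N, diagMatrix R N π i' j * diagMatrix R N π' j i
      = if stack π π' ≤ Setoid.ker (Sum.elim (Sum.elim i i') j) then 1 else 0 := by
    intro j
    have hs := stack_le_ker π π' (Sum.elim i i') j
    simp only [Sum.elim_inl, Sum.elim_inr] at hs
    simp only [diagMatrix]
    by_cases hA : ∀ a b, π a b → Sum.elim j i' a = Sum.elim j i' b
    · by_cases hB : ∀ a b, π' a b → Sum.elim i j a = Sum.elim i j b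
      · rw [if_pos hA, if_pos hB, if_pos (hs.2 ⟨hA, hB⟩), mul_one]
      · rw [if_neg hB, if_neg (fun h => hB (hs.1 h).2), mul_zero]
    · rw [if_neg hA, if_neg (fun h => hA (hs.1 h).1), zero_mul]
  rw [Finset.sum_congr rfl fun j _ => h1 j, Finset.sum_boole]
  by_cases ho : ∀ a b, comp π π' a b → Sum.elim i i' a = Sum.elim i i' b
  · have := card_middle (N := N) π π' (Sum.elim i i') ho
    rw [Nat.card_eq_fintype_card, Fintype.card_subtype] at this
    rw [this, diagMatrix, if_pos ho]
    simp
  · rw [diagMatrix, if_neg ho, mul_zero, Finset.filter_eq_empty_iff.2, Finset.card_empty,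
      Nat.cast_zero]
    intro j _ hj
    exact ho fun a b hab => hj hab

theorem diagMatrix_idPart (k : ℕ) (R : Type*) [CommSemiring R] (N : ℕ) :
    diagMatrix R N (idPart k) = 1 := by
  classical
  ext i' i
  rw [diagMatrix, Matrix.one_apply]
  congr 1
  apply propext
  constructor
  · intro h
    funext x
    exact (h (Sum.inl x) (Sum.inr x) rfl).symm
  · rintro rfl (a | a) (b | b) h <;> (change _ = _ at h; simp at h; subst h; rfl)

/-- The `D_π`, with their power of `M`, determine `π` once `M` is large. -/
theorem diagMatrix_inj {k M : ℕ} (hM : 2 * k + 2 ≤ M) {a b : ℕ} {π ρ : SetPart k}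
    (h : (M : ℕ) ^ a • diagMatrix ℕ M π = M ^ b • diagMatrix ℕ M ρ) : a = b ∧ π = ρ := by
  classical
  have hM0 : 0 < M := by omega
  have ent : ∀ i' i, M ^ a * diagMatrix ℕ M π i' i = M ^ b * diagMatrix ℕ M ρ i' i := by
    intro i' i
    simpa [Matrix.smul_apply] using congrFun (congrFun h i') i
  constructor
  · have := ent (fun _ => ⟨0, hM0⟩) (fun _ => ⟨0, hM0⟩)
    have c : ∀ x : Fin k ⊕ Fin k, Sum.elim (fun _ => (⟨0, hM0⟩ : Fin M)) (fun _ => ⟨0, hM0⟩) x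
        = ⟨0, hM0⟩ := by rintro (x | x) <;> rfl
    simp only [diagMatrix, c, implies_true, if_true, mul_one] at this
    exact Nat.pow_right_injective (by omega) this
  · have key : ∀ {a b : ℕ} {π ρ : SetPart k},
        (∀ i' i, M ^ a * diagMatrix ℕ M π i' i = M ^ b * diagMatrix ℕ M ρ i' i) → ρ ≤ π := by
      intro a b π ρ ent
      have hc : Nat.card (Quotient π) ≤ Nat.card (Fin M) := by
        refine le_trans (Nat.card_le_card_of_surjective (Quotient.mk π) Quotient.mk_surjective) ?_
        simp
        omega
      obtain ⟨f⟩ := Function.Embedding.nonempty_of_card_le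
        (α := Quotient π) (β := Fin M) (by simpa [Nat.card_eq_fintype_card] using hc)
      have := ent (fun x => f (Quotient.mk π (Sum.inr x))) (fun x => f (Quotient.mk π (Sum.inl x)))
      have c : ∀ x : Fin k ⊕ Fin k, Sum.elim (fun x => f (Quotient.mk π (Sum.inl x)))
          (fun x => f (Quotient.mk π (Sum.inr x))) x = f (Quotient.mk π x) := by
        rintro (x | x) <;> rfl
      simp only [diagMatrix, c] at this
      rw [if_pos (fun x y hxy => by rw [Quotient.sound hxy])] at this
      by_cases hr : ∀ x y, ρ x y → f (Quotient.mk π x) = f (Quotient.mk π y)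
      · intro x y hxy
        exact Quotient.exact (f.injective (hr x y hxy))
      · rw [if_neg hr, mul_one, mul_zero] at this
        exact absurd this (pow_pos hM0 a).ne'
    exact le_antisymm (key fun i' i => (ent i' i).symm) (key ent)

theorem comp_assoc {k : ℕ} (π ρ σ : SetPart k) :
    loops π ρ + loops (comp π ρ) σ = loops ρ σ + loops π (comp ρ σ) ∧
      comp (comp π ρ) σ = comp π (comp ρ σ) := by
  refine diagMatrix_inj (k := k) (M := 2 * k + 2) le_rfl ?_
  have h := mul_assoc (diagMatrix ℕ (2 * k + 2) π) (diagMatrix ℕ (2 * k + 2) ρ)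
    (diagMatrix ℕ (2 * k + 2) σ)
  simp only [diagMatrix_mul, Matrix.smul_mul, Matrix.mul_smul, smul_smul] at h
  simpa only [pow_add, Nat.cast_id] using h

theorem id_comp {k : ℕ} (π : SetPart k) : loops (idPart k) π = 0 ∧ comp (idPart k) π = π := by
  refine diagMatrix_inj (k := k) (M := 2 * k + 2) le_rfl ?_
  have h := one_mul (diagMatrix ℕ (2 * k + 2) π)
  rw [← diagMatrix_idPart, diagMatrix_mul] at h
  simpa using h

theorem comp_id {k : ℕ} (π : SetPart k) : loops π (idPart k) = 0 ∧ comp π (idPart k) = π := by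
  refine diagMatrix_inj (k := k) (M := 2 * k + 2) le_rfl ?_
  have h := mul_one (diagMatrix ℕ (2 * k + 2) π)
  rw [← diagMatrix_idPart, diagMatrix_mul] at h
  simpa using h

/-! ### The partition algebra `P_k(N)` -/

/-- The partition algebra `P_k(N)` over `ℂ`: the vector space with basis the diagrams `d_π`. -/
def PartitionAlgebra (k _N : ℕ) : Type := SetPart k →₀ ℂ

noncomputable instance (k N : ℕ) : AddCommGroup (PartitionAlgebra k N) :=
  inferInstanceAs (AddCommGroup (SetPart k →₀ ℂ))

noncomputable instance (k N : ℕ) : Module ℂ (PartitionAlgebra k N) :=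
  inferInstanceAs (Module ℂ (SetPart k →₀ ℂ))

/-- The diagram basis `d_π` of `P_k(N)`. -/
noncomputable def diagBasis (k N : ℕ) : Module.Basis (SetPart k) ℂ (PartitionAlgebra k N) :=
  Module.Basis.ofRepr (LinearEquiv.refl ℂ (SetPart k →₀ ℂ))

/-- The bilinear extension of `d_π d_π' = N ^ c d_π''`. -/
noncomputable def mulLin (k N : ℕ) :
    PartitionAlgebra k N →ₗ[ℂ] PartitionAlgebra k N →ₗ[ℂ] PartitionAlgebra k N :=
  (diagBasis k N).constr ℂ fun π => (diagBasis k N).constr ℂ fun π' =>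
    (N : ℂ) ^ loops π π' • diagBasis k N (comp π π')

noncomputable instance (k N : ℕ) : Mul (PartitionAlgebra k N) := ⟨fun x y => mulLin k N x y⟩

noncomputable instance (k N : ℕ) : One (PartitionAlgebra k N) := ⟨diagBasis k N (idPart k)⟩

theorem mul_def' {k N : ℕ} (x y : PartitionAlgebra k N) : x * y = mulLin k N x y := rfl

theorem one_def' {k N : ℕ} : (1 : PartitionAlgebra k N) = diagBasis k N (idPart k) := rfl

theorem diagBasis_mul {k N : ℕ} (π π' : SetPart k) :
    diagBasis k N π * diagBasis k N π' = (N : ℂ) ^ loops π π' • diagBasis k N (comp π π') := by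
  rw [mul_def', mulLin, Module.Basis.constr_basis, Module.Basis.constr_basis]

theorem induct {k N : ℕ} {p : PartitionAlgebra k N → Prop} (x : PartitionAlgebra k N)
    (hb : ∀ π, p (diagBasis k N π)) (h0 : p 0) (ha : ∀ x y, p x → p y → p (x + y))
    (hs : ∀ (c : ℂ) x, p x → p (c • x)) : p x := by
  have hx : x ∈ Submodule.span ℂ (Set.range (diagBasis k N)) := by
    rw [Module.Basis.span_eq]; trivial
  induction hx using Submodule.span_induction with
  | mem _ h => obtain ⟨π, rfl⟩ := h; exact hb π
  | zero => exact h0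
  | add x y _ _ hx hy => exact ha x y hx hy
  | smul c x _ hx => exact hs c x hx

theorem smul_mul' {k N : ℕ} (c : ℂ) (x y : PartitionAlgebra k N) : c • x * y = c • (x * y) := by
  simp [mul_def']

theorem mul_smul' {k N : ℕ} (c : ℂ) (x y : PartitionAlgebra k N) : x * c • y = c • (x * y) := by
  simp [mul_def']

theorem add_mul' {k N : ℕ} (x y z : PartitionAlgebra k N) : (x + y) * z = x * z + y * z := by
  simp [mul_def']

theorem mul_add' {k N : ℕ} (x y z : PartitionAlgebra k N) : x * (y + z) = x * y + x * z := by
  simp [mul_def']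

theorem zero_mul' {k N : ℕ} (x : PartitionAlgebra k N) : 0 * x = 0 := by
  simp [mul_def']

theorem mul_zero' {k N : ℕ} (x : PartitionAlgebra k N) : x * 0 = 0 := by
  simp [mul_def']

theorem mul_assoc' {k N : ℕ} (x y z : PartitionAlgebra k N) : x * y * z = x * (y * z) := by
  induction x using induct with
  | h0 => simp only [zero_mul']
  | ha x x' hx hx' => simp only [add_mul', hx, hx']
  | hs c x hx => simp only [smul_mul', hx]
  | hb π =>
  induction y using induct with
  | h0 => simp only [zero_mul', mul_zero']
  | ha x x' hx hx' => simp only [add_mul', mul_add', hx, hx']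
  | hs c x hx => simp only [smul_mul', mul_smul', hx]
  | hb ρ =>
  induction z using induct with
  | h0 => simp only [mul_zero']
  | ha x x' hx hx' => simp only [mul_add', hx, hx']
  | hs c x hx => simp only [mul_smul', hx]
  | hb σ =>
    obtain ⟨h1, h2⟩ := comp_assoc π ρ σ
    rw [diagBasis_mul, diagBasis_mul, smul_mul', mul_smul', diagBasis_mul, diagBasis_mul,
      smul_smul, smul_smul, ← pow_add, ← pow_add, h1, h2]

theorem one_mul' {k N : ℕ} (x : PartitionAlgebra k N) : 1 * x = x := by
  induction x using induct with
  | h0 => simp only [mul_zero']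
  | ha x x' hx hx' => simp only [mul_add', hx, hx']
  | hs c x hx => simp only [mul_smul', hx]
  | hb π => rw [one_def', diagBasis_mul, (id_comp π).1, (id_comp π).2, pow_zero, one_smul]

theorem mul_one' {k N : ℕ} (x : PartitionAlgebra k N) : x * 1 = x := by
  induction x using induct with
  | h0 => simp only [zero_mul']
  | ha x x' hx hx' => simp only [add_mul', hx, hx']
  | hs c x hx => simp only [smul_mul', hx]
  | hb π => rw [one_def', diagBasis_mul, (comp_id π).1, (comp_id π).2, pow_zero, one_smul]

noncomputable instance (k N : ℕ) : Ring (PartitionAlgebra k N) :=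
  { (inferInstance : AddCommGroup (PartitionAlgebra k N)),
    (inferInstance : Mul (PartitionAlgebra k N)),
    (inferInstance : One (PartitionAlgebra k N)) with
    left_distrib := mul_add'
    right_distrib := add_mul'
    zero_mul := zero_mul'
    mul_zero := mul_zero'
    mul_assoc := mul_assoc'
    one_mul := one_mul'
    mul_one := mul_one' }

noncomputable instance (k N : ℕ) : Algebra ℂ (PartitionAlgebra k N) :=
  Algebra.ofModule smul_mul' mul_smul'

/-- The transpose `d ↦ d^T`, the linear extension of the exchange of primed and unprimed elements
(reflection of diagrams). -/
noncomputable def transpose (k N : ℕ) : PartitionAlgebra k N →ₗ[ℂ] PartitionAlgebra k N :=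
  (diagBasis k N).constr ℂ fun π => diagBasis k N (flip π)

/-- The homomorphism `d_π ↦ D_π` from `P_k(N)` to the endomorphisms of `V_N^{⊗k}`, written as
matrices in the basis `e_{i_1} ⊗ … ⊗ e_{i_k}`. -/
noncomputable def toMat (k N : ℕ) :
    PartitionAlgebra k N →ₐ[ℂ] Matrix (Fin k → Fin N) (Fin k → Fin N) ℂ :=
  AlgHom.ofLinearMap ((diagBasis k N).constr ℂ fun π => diagMatrix ℂ N π)
    (by rw [one_def', Module.Basis.constr_basis, diagMatrix_idPart])
    (by
      intro x y
      induction x using induct with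
      | h0 => simp only [zero_mul, map_zero]
      | ha x x' hx hx' => simp only [add_mul, map_add, hx, hx']
      | hs c x hx => simp only [smul_mul_assoc, map_smul, hx]
      | hb π =>
      induction y using induct with
      | h0 => simp only [mul_zero, map_zero]
      | ha x x' hx hx' => simp only [mul_add, map_add, hx, hx']
      | hs c x hx => simp only [mul_smul_comm, map_smul, hx]
      | hb ρ =>
        rw [diagBasis_mul, map_smul, Module.Basis.constr_basis, Module.Basis.constr_basis,
          Module.Basis.constr_basis, diagMatrix_mul])

theorem toMat_diagBasis {k N : ℕ} (π : SetPart k) :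
    toMat k N (diagBasis k N π) = diagMatrix ℂ N π :=
  (diagBasis k N).constr_basis ℂ _ _

/-- The bilinear form `⟨d, d'⟩ = Tr_{V_N^{⊗k}} (D (D')^T)` on `P_k(N)`. -/
noncomputable def traceForm (k N : ℕ) : LinearMap.BilinForm ℂ (PartitionAlgebra k N) :=
  LinearMap.mk₂ ℂ
    (fun d d' : PartitionAlgebra k N => Matrix.trace (toMat k N d * (toMat k N d').transpose))
    (fun x y z => by rw [map_add, add_mul, Matrix.trace_add])
    (fun c x y => by rw [map_smul, Matrix.smul_mul, Matrix.trace_smul])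
    (fun x y z => by rw [map_add, Matrix.transpose_add, mul_add, Matrix.trace_add])
    (fun c x y => by
      rw [map_smul, Matrix.transpose_smul, Matrix.mul_smul _ c, Matrix.trace_smul])

/-- The Gram matrix `g_{ij} = Tr_{V_N^{⊗k}} (B_i B_j)` of a basis of `P_k(N)`. -/
noncomputable def gram {k N : ℕ} {ι : Type*} (b : Module.Basis ι ℂ (PartitionAlgebra k N)) :
    Matrix ι ι ℂ :=
  fun i j => Matrix.trace (toMat k N (b i) * toMat k N (b j))

/-- The dual elements `b_i^† = ∑_j (g⁻¹)_{ji} b_j^T`. -/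
noncomputable def dual {k N : ℕ} {ι : Type*} [Fintype ι] [DecidableEq ι]
    (b : Module.Basis ι ℂ (PartitionAlgebra k N)) (i : ι) : PartitionAlgebra k N :=
  ∑ j, (gram b)⁻¹ j i • transpose k N (b j)

/-! ### Representations of `S_N` -/

/-- The space `V_N^{⊗k}`, a tensor being given by its components `T^{i_1 … i_k}` in the basis
`e_{i_1} ⊗ … ⊗ e_{i_k}`. -/
abbrev TensorSpace (k N : ℕ) : Type := (Fin k → Fin N) → ℂ

/-- The diagonal action of `S_N` on `V_N^{⊗k}`, which sends `e_{i_1} ⊗ … ⊗ e_{i_k}` to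
`e_{σ i_1} ⊗ … ⊗ e_{σ i_k}`. -/
def tensorRep (k N : ℕ) : Representation ℂ (Equiv.Perm (Fin N)) (TensorSpace k N) where
  toFun σ := LinearMap.funLeft ℂ ℂ fun i => σ.symm ∘ i
  map_one' := rfl
  map_mul' _ _ := rfl

/-- `Λ_{k,N}`: the Young diagrams `λ` with `N` boxes and at most `k` boxes below the first row. -/
def Lam (k N : ℕ) : Type := {μ : YoungDiagram // μ.card = N ∧ N - μ.rowLen 0 ≤ k}

/-- A filling of the boxes of `λ` by the numbers `1,…,N` (each used once). -/
noncomputable def filling {k N : ℕ} (l : Lam k N) : l.1.cells ≃ Fin N :=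
  Finset.equivFinOfCardEq l.2.1

open Classical in
/-- The sum of the permutations that preserve the rows of the filling. -/
noncomputable def rowSum {k N : ℕ} (l : Lam k N) : MonoidAlgebra ℂ (Equiv.Perm (Fin N)) :=
  ∑ σ : Equiv.Perm (Fin N),
    if ∀ x, ((filling l).symm (σ x)).1.1 = ((filling l).symm x).1.1
    then MonoidAlgebra.of ℂ _ σ else 0

open Classical in
/-- The signed sum of the permutations that preserve the columns of the filling. -/
noncomputable def colSum {k N : ℕ} (l : Lam k N) : MonoidAlgebra ℂ (Equiv.Perm (Fin N)) :=
  ∑ σ : Equiv.Perm (Fin N),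
    if ∀ x, ((filling l).symm (σ x)).1.2 = ((filling l).symm x).1.2
    then ((Equiv.Perm.sign σ : ℤ) : ℂ) • MonoidAlgebra.of ℂ _ σ else 0

/-- The irreducible representation `V_λ` of `S_N`: the left ideal of the group algebra generated
by the Young symmetrizer of `λ` (up to isomorphism independent of the filling). -/
noncomputable abbrev V {k N : ℕ} (l : Lam k N) :
    Ideal (MonoidAlgebra ℂ (Equiv.Perm (Fin N))) :=
  Ideal.span {rowSum l * colSum l}

/-- The action of `S_N` on `V_λ` by left multiplication. -/
noncomputable def vRep {k N : ℕ} (l : Lam k N) :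
    Representation ℂ (Equiv.Perm (Fin N)) (V l) :=
  Representation.ofModule' (V l)

/-- The multiplicity space `Z_λ = Hom_{S_N}(V_λ, V_N^{⊗k})` of `V_λ` in `V_N^{⊗k}`. -/
abbrev Z {k N : ℕ} (l : Lam k N) : Type :=
  Representation.IntertwiningMap (vRep l) (tensorRep k N)

theorem diagMatrix_perm {k N : ℕ} (π : SetPart k) (σ : Equiv.Perm (Fin N))
    (i' i : Fin k → Fin N) : diagMatrix ℂ N π (σ ∘ i') (σ ∘ i) = diagMatrix ℂ N π i' i := by
  have h : ∀ a, Sum.elim (σ ∘ i) (σ ∘ i') a = σ (Sum.elim i i' a) := by rintro (a | a) <;> rfl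
  have h' : ∀ a b, Sum.elim (σ ∘ i) (σ ∘ i') a = Sum.elim (σ ∘ i) (σ ∘ i') b ↔
      Sum.elim i i' a = Sum.elim i i' b := fun a b => by rw [h, h, σ.injective.eq_iff]
  simp only [diagMatrix]
  by_cases hA : ∀ a b, π a b → Sum.elim i i' a = Sum.elim i i' b
  · rw [if_pos hA, if_pos fun a b hab => (h' a b).2 (hA a b hab)]
  · rw [if_neg hA, if_neg fun hB => hA fun a b hab => (h' a b).1 (hB a b hab)]

theorem toMat_perm {k N : ℕ} (d : PartitionAlgebra k N) (σ : Equiv.Perm (Fin N))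
    (i' i : Fin k → Fin N) : toMat k N d (σ ∘ i') (σ ∘ i) = toMat k N d i' i := by
  induction d using induct with
  | h0 => simp
  | ha x y hx hy => simp [hx, hy]
  | hs c x hx => simp [hx]
  | hb π => rw [toMat_diagBasis, diagMatrix_perm]

/-- An element of `P_k(N)` as an `S_N`-equivariant map of `V_N^{⊗k}`. -/
noncomputable def toEquivariant {k N : ℕ} (d : PartitionAlgebra k N) :
    Representation.IntertwiningMap (tensorRep k N) (tensorRep k N) where
  toLinearMap := Matrix.mulVecLin (toMat k N d)
  isIntertwining' σ := by
    ext1 i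
    ext1
    funext i'
    change ∑ j, toMat k N d i' j * _ = ∑ j, toMat k N d (σ.symm ∘ i') j * _
    refine Fintype.sum_equiv (Equiv.arrowCongr (Equiv.refl _) σ.symm) _ _ fun j => ?_
    rw [← toMat_perm d σ.symm]
    rfl

/-- The action of `P_k(N)` on the multiplicity space `Z_λ`, by composition. -/
noncomputable def zRep {k N : ℕ} (l : Lam k N) :
    PartitionAlgebra k N →ₐ[ℂ] Module.End ℂ (Z l) :=
  AlgHom.ofLinearMap
    { toFun := fun d =>
        { toFun := fun f => (toEquivariant d).comp f
          map_add' := fun f g => DFunLike.ext _ _ fun v => map_add (toEquivariant d) _ _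
          map_smul' := fun c f => DFunLike.ext _ _ fun v => map_smul (toEquivariant d) _ _ }
      map_add' := fun d d' => LinearMap.ext fun f => DFunLike.ext _ _ fun v => by
        change Matrix.mulVec (toMat k N (d + d')) (f v)
          = Matrix.mulVec (toMat k N d) (f v) + Matrix.mulVec (toMat k N d') (f v)
        rw [map_add, Matrix.add_mulVec]
      map_smul' := fun c d => LinearMap.ext fun f => DFunLike.ext _ _ fun v => by
        change Matrix.mulVec (toMat k N (c • d)) (f v) = c • Matrix.mulVec (toMat k N d) (f v)
        rw [map_smul, Matrix.smul_mulVec] }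
    (LinearMap.ext fun f => DFunLike.ext _ _ fun v => by
      change Matrix.mulVec (toMat k N 1) (f v) = f v
      rw [map_one, Matrix.one_mulVec])
    (fun d d' => LinearMap.ext fun f => DFunLike.ext _ _ fun v => by
      change Matrix.mulVec (toMat k N (d * d')) (f v)
        = Matrix.mulVec (toMat k N d) (Matrix.mulVec (toMat k N d') (f v))
      rw [map_mul, Matrix.mulVec_mulVec])

/-- `dim V_λ`, the dimension of the irreducible representation of `S_N`. -/
noncomputable def dimV {k N : ℕ} (l : Lam k N) : ℕ := Module.finrank ℂ (V l)

/-- `m^λ_{k,N} = dim Z_λ`, the dimension of the representation of `P_k(N)`. -/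
noncomputable def dimZ {k N : ℕ} (l : Lam k N) : ℕ := Module.finrank ℂ (Z l)

/-! ### Clebsch–Gordan bases, matrix elements and matrix units -/

/-- A choice of bases `(E^λ_a)` of `V_λ` and `(E^λ_α)` of `Z_λ` for which the Clebsch–Gordan
coefficients `(C^λ_{a,α})^{i_1 … i_k}`, that is, the components of the image
`E^λ_α(E^λ_a)` of `E^λ_a ⊗ E^λ_α` in `V_N^{⊗k}`, are real and orthonormal. -/
structure ClebschGordan (k N : ℕ) where
  basisV : ∀ l : Lam k N, Module.Basis (Fin (dimV l)) ℂ (V l)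
  basisZ : ∀ l : Lam k N, Module.Basis (Fin (dimZ l)) ℂ (Z l)
  real : ∀ (l : Lam k N) (a : Fin (dimV l)) (α : Fin (dimZ l)) (i : Fin k → Fin N),
    (starRingEnd ℂ) (basisZ l α (basisV l a) i) = basisZ l α (basisV l a) i
  orthonormal : ∀ (l : Lam k N) (a b : Fin (dimV l)) (α β : Fin (dimZ l)),
    ∑ i : Fin k → Fin N,
        (starRingEnd ℂ) (basisZ l α (basisV l a) i) * basisZ l β (basisV l b) i
      = if a = b ∧ α = β then 1 else 0

/-- The irreducible matrix representation `D^λ` of `P_k(N)`: the matrix of the action on `Z_λ` in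
the basis `(E^λ_α)`, so that `d E^λ_β = ∑_α D^λ_{αβ}(d) E^λ_α`. -/
noncomputable def ClebschGordan.D {k N : ℕ} (C : ClebschGordan k N) (l : Lam k N)
    (d : PartitionAlgebra k N) : Matrix (Fin (dimZ l)) (Fin (dimZ l)) ℂ :=
  LinearMap.toMatrix (C.basisZ l) (C.basisZ l) (zRep l d)

/-- `Q^λ_{αβ} = ∑_i dim V_λ D^λ_{αβ}(b_i^†) b_i`. -/
noncomputable def ClebschGordan.Q {k N : ℕ} (C : ClebschGordan k N) {ι : Type*} [Fintype ι]
    [DecidableEq ι] (b : Module.Basis ι ℂ (PartitionAlgebra k N)) (l : Lam k N)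
    (α β : Fin (dimZ l)) : PartitionAlgebra k N :=
  ∑ i, ((dimV l : ℂ) * C.D l (dual b i) α β) • b i

end PartAlg

/-! For N ≥ 2k the map d ↦ D identifies P_k(N) with the full commutant of S_N on V_N^{⊗k}. A
commuting matrix is constant on S_N-orbits of index tuples; 2k positions can realise every pattern
of coincidences, so the orbits are the set partitions, and the `D_π` are a unitriangular transform
of the orbit indicators (`toMat_injective`, `exists_toMat_eq`). The commutant is closed under
complex conjugation, so the trace form is non-degenerate.

In the commutant the matrix units are visible: ∑_a C_{a,α} C_{a,β}^T is invariant because S_N acts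
on V_λ by orthogonal matrices. Its trace pairing with d is dim V_λ · D^λ_{αβ}(d), and expansion in
dual bases shows that it is the image of Q^λ_{αβ} (`toMat_Q`). Orthonormality within λ and
orthogonality between different λ give the elementary matrices (`D_Q_self`, `D_Q_of_ne`), hence
surjectivity of d ↦ (D^λ(d))_λ. Injectivity is completeness: every tensor is a sum of values of
intertwiners from the V_λ with λ ∈ Λ_{k,N} (`eq_zero_of_zRep_eq_zero`). All identities between the Q
then follow from those between elementary matrices.

The facts about V_λ come from Young symmetrizers c = ab. Von Neumann's lemma gives c² = nc and c x
c' = 0 for different shapes. Averaging c over conjugation gives orthogonal central elements, as many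
as there are conjugacy classes, so they span the centre and decompose 1. Positivity, (x^*x)(1) =
∑|x_g|² for real x, supplies the required non-vanishing. On V_N^{⊗k} the symmetrizer acts as zero if
more than k boxes lie below the first row, and for N ≥ 2k only then. -/

namespace PartAlg

/-! ### The group algebra of a finite group -/

section GroupAlgebra

variable {G : Type*} [Group G]

/-- The linear extension of `g ↦ g⁻¹` to the group algebra. -/
noncomputable def invMap (x : MonoidAlgebra ℂ G) : MonoidAlgebra ℂ G :=
  .ofCoeff (Finsupp.equivMapDomain (Equiv.inv G) x.coeff)

theorem coeff_invMap (x : MonoidAlgebra ℂ G) (g : G) : (invMap x).coeff g = x.coeff g⁻¹ := rfl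

theorem invMap_add (x y : MonoidAlgebra ℂ G) : invMap (x + y) = invMap x + invMap y := by
  ext g
  simp [coeff_invMap]

theorem invMap_smul (r : ℂ) (x : MonoidAlgebra ℂ G) : invMap (r • x) = r • invMap x := by
  ext g
  simp [coeff_invMap]

theorem invMap_zero : invMap (0 : MonoidAlgebra ℂ G) = 0 := by
  ext g
  simp [coeff_invMap]

theorem invMap_invMap (x : MonoidAlgebra ℂ G) : invMap (invMap x) = x := by
  ext g
  simp [coeff_invMap]

theorem invMap_single (g : G) (r : ℂ) :
    invMap (MonoidAlgebra.single g r) = MonoidAlgebra.single g⁻¹ r := by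
  classical
  ext h
  rw [coeff_invMap, MonoidAlgebra.coeff_single, MonoidAlgebra.coeff_single, Finsupp.single_apply,
    Finsupp.single_apply]
  congr 1
  rw [eq_iff_iff]
  constructor
  · rintro rfl; simp
  · rintro rfl; simp

theorem invMap_mul (x y : MonoidAlgebra ℂ G) : invMap (x * y) = invMap y * invMap x := by
  induction x using MonoidAlgebra.induction_linear with
  | zero => simp [invMap_zero]
  | add x x' hx hx' => rw [add_mul, invMap_add, hx, hx', invMap_add, mul_add]
  | single g r =>
  induction y using MonoidAlgebra.induction_linear with
  | zero => simp [invMap_zero]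
  | add x x' hx hx' => rw [mul_add, invMap_add, hx, hx', invMap_add, add_mul]
  | single h s =>
    rw [MonoidAlgebra.single_mul_single, invMap_single, invMap_single, invMap_single,
      MonoidAlgebra.single_mul_single, mul_inv_rev, mul_comm r s]

/-- Complex conjugation of the coefficients of an element of the group algebra. -/
noncomputable def conjMap : MonoidAlgebra ℂ G →+* MonoidAlgebra ℂ G :=
  MonoidAlgebra.mapRingHom G (starRingEnd ℂ)

theorem coeff_conjMap (x : MonoidAlgebra ℂ G) (g : G) :
    (conjMap x).coeff g = (starRingEnd ℂ) (x.coeff g) := by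
  simp [conjMap]

theorem conjMap_smul (r : ℂ) (x : MonoidAlgebra ℂ G) :
    conjMap (r • x) = (starRingEnd ℂ) r • conjMap x := by
  ext g
  simp [coeff_conjMap]

theorem conjMap_single (g : G) (r : ℂ) :
    conjMap (MonoidAlgebra.single g r) = MonoidAlgebra.single g ((starRingEnd ℂ) r) := by
  simp [conjMap]

theorem conjMap_invMap (x : MonoidAlgebra ℂ G) : conjMap (invMap x) = invMap (conjMap x) := by
  ext g
  simp [coeff_conjMap, coeff_invMap]

theorem coeff_mul_eq_sum [Fintype G] (x y : MonoidAlgebra ℂ G) (g : G) :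
    (x * y).coeff g = ∑ h, x.coeff h * y.coeff (h⁻¹ * g) := by
  rw [MonoidAlgebra.coeff_mul_apply_left, Finsupp.sum_fintype]
  simp

theorem coeff_invMap_mul_one [Fintype G] (x y : MonoidAlgebra ℂ G) :
    (invMap x * y).coeff 1 = ∑ g, x.coeff g * y.coeff g := by
  rw [coeff_mul_eq_sum]
  refine Fintype.sum_equiv (Equiv.inv G) _ _ fun h => ?_
  simp [coeff_invMap]

/-- For real x this coefficient is ∑|x_g|². This positivity is the source of the non-vanishing of
squares below. -/
theorem invMap_mul_self_coeff_ne_zero [Fintype G] {x : MonoidAlgebra ℂ G} (hx : conjMap x = x)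
    (h0 : x ≠ 0) : (invMap x * x).coeff 1 ≠ 0 := by
  intro h
  apply h0
  rw [coeff_invMap_mul_one] at h
  have h1 : ∀ g, x.coeff g * x.coeff g = ((Complex.normSq (x.coeff g) : ℝ) : ℂ) := by
    intro g
    rw [Complex.normSq_eq_conj_mul_self, ← coeff_conjMap, hx]
  simp only [h1] at h
  rw [← Complex.ofReal_sum, Complex.ofReal_eq_zero,
    Finset.sum_eq_zero_iff_of_nonneg fun _ _ => Complex.normSq_nonneg _] at h
  ext g
  simpa using h g (Finset.mem_univ g)

/-- Sum of the conjugates of an element of the group algebra. -/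
noncomputable def classSum [Fintype G] (x : MonoidAlgebra ℂ G) : MonoidAlgebra ℂ G :=
  ∑ g : G, MonoidAlgebra.single g 1 * x * MonoidAlgebra.single g⁻¹ 1

theorem coeff_classSum [Fintype G] (x : MonoidAlgebra ℂ G) (h : G) :
    (classSum x).coeff h = ∑ g, x.coeff (g⁻¹ * h * g) := by
  simp [classSum, mul_assoc]

theorem coeff_classSum_conj [Fintype G] (x : MonoidAlgebra ℂ G) (h g : G) :
    (classSum x).coeff (g * h * g⁻¹) = (classSum x).coeff h := by
  rw [coeff_classSum, coeff_classSum]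
  refine Fintype.sum_equiv (Equiv.mulLeft g⁻¹) _ _ fun a => ?_
  simp [mul_assoc]

theorem conjMap_classSum [Fintype G] {x : MonoidAlgebra ℂ G} (hx : conjMap x = x) :
    conjMap (classSum x) = classSum x := by
  simp [classSum, map_sum, map_mul, hx, conjMap_single]

end GroupAlgebra

/-! ### Row and column symmetrizers -/

section Symmetrizers

variable {N : ℕ}

/-- The permutations that preserve a labelling of `1,…,N`. -/
def labelStab (r : Fin N → ℕ) : Subgroup (Equiv.Perm (Fin N)) where
  carrier := {σ | ∀ x, r (σ x) = r x}
  mul_mem' {σ τ} hσ hτ x := (hσ (τ x)).trans (hτ x)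
  one_mem' _ := rfl
  inv_mem' {σ} hσ x := by
    have := hσ (σ⁻¹ x)
    rw [show σ (σ⁻¹ x) = x from σ.apply_symm_apply x] at this
    exact this.symm

theorem mem_labelStab {r : Fin N → ℕ} {σ : Equiv.Perm (Fin N)} :
    σ ∈ labelStab r ↔ ∀ x, r (σ x) = r x := Iff.rfl

theorem swap_mem_labelStab {r : Fin N → ℕ} {x y : Fin N} (h : r x = r y) :
    Equiv.swap x y ∈ labelStab r := by
  intro z
  by_cases hx : z = x
  · subst hx; rw [Equiv.swap_apply_left, h]
  by_cases hy : z = y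
  · subst hy; rw [Equiv.swap_apply_right, h]
  rw [Equiv.swap_apply_of_ne_of_ne hx hy]

open Classical in
/-- The sum of the permutations that preserve a labelling. -/
noncomputable def symSum (r : Fin N → ℕ) : MonoidAlgebra ℂ (Equiv.Perm (Fin N)) :=
  ∑ σ : Equiv.Perm (Fin N), if ∀ x, r (σ x) = r x then MonoidAlgebra.of ℂ _ σ else 0

open Classical in
/-- The signed sum of the permutations that preserve a labelling. -/
noncomputable def altSum (c : Fin N → ℕ) : MonoidAlgebra ℂ (Equiv.Perm (Fin N)) :=
  ∑ σ : Equiv.Perm (Fin N),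
    if ∀ x, c (σ x) = c x
    then ((Equiv.Perm.sign σ : ℤ) : ℂ) • MonoidAlgebra.of ℂ _ σ else 0

open Classical in
theorem coeff_symSum (r : Fin N → ℕ) (σ : Equiv.Perm (Fin N)) :
    (symSum r).coeff σ = if σ ∈ labelStab r then 1 else 0 := by
  rw [symSum, MonoidAlgebra.coeff_sum, Finsupp.finsetSum_apply, Finset.sum_eq_single σ]
  · simp only [mem_labelStab]
    split_ifs <;> simp
  · intro τ _ h
    split_ifs <;> simp [h]
  · simp

open Classical in
theorem coeff_altSum (c : Fin N → ℕ) (σ : Equiv.Perm (Fin N)) :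
    (altSum c).coeff σ = if σ ∈ labelStab c then ((Equiv.Perm.sign σ : ℤ) : ℂ) else 0 := by
  rw [altSum, MonoidAlgebra.coeff_sum, Finsupp.finsetSum_apply, Finset.sum_eq_single σ]
  · simp only [mem_labelStab]
    split_ifs <;> simp
  · intro τ _ h
    split_ifs <;> simp [h]
  · simp

theorem single_mul_symSum {r : Fin N → ℕ} {σ : Equiv.Perm (Fin N)} (h : σ ∈ labelStab r) :
    MonoidAlgebra.single σ 1 * symSum r = symSum r := by
  ext τ
  rw [MonoidAlgebra.coeff_single_mul_apply, coeff_symSum, coeff_symSum, one_mul,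
    (labelStab r).mul_mem_cancel_left ((labelStab r).inv_mem h)]

theorem symSum_mul_single {r : Fin N → ℕ} {σ : Equiv.Perm (Fin N)} (h : σ ∈ labelStab r) :
    symSum r * MonoidAlgebra.single σ 1 = symSum r := by
  ext τ
  rw [MonoidAlgebra.coeff_mul_single_apply, coeff_symSum, coeff_symSum, mul_one,
    (labelStab r).mul_mem_cancel_right ((labelStab r).inv_mem h)]

theorem single_mul_altSum {c : Fin N → ℕ} {σ : Equiv.Perm (Fin N)} (h : σ ∈ labelStab c) :
    MonoidAlgebra.single σ 1 * altSum c = ((Equiv.Perm.sign σ : ℤ) : ℂ) • altSum c := by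
  ext τ
  rw [MonoidAlgebra.coeff_single_mul_apply, MonoidAlgebra.coeff_smul_apply, coeff_altSum,
    coeff_altSum, one_mul, (labelStab c).mul_mem_cancel_left ((labelStab c).inv_mem h)]
  split_ifs <;> simp

theorem invMap_symSum (r : Fin N → ℕ) : invMap (symSum r) = symSum r := by
  ext τ
  rw [coeff_invMap, coeff_symSum, coeff_symSum, inv_mem_iff]

theorem invMap_altSum (c : Fin N → ℕ) : invMap (altSum c) = altSum c := by
  ext τ
  rw [coeff_invMap, coeff_altSum, coeff_altSum, inv_mem_iff, Equiv.Perm.sign_inv]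

theorem conjMap_symSum (r : Fin N → ℕ) : conjMap (symSum r) = symSum r := by
  ext τ
  rw [coeff_conjMap, coeff_symSum]
  split_ifs <;> simp

theorem conjMap_altSum (c : Fin N → ℕ) : conjMap (altSum c) = altSum c := by
  ext τ
  rw [coeff_conjMap, coeff_altSum]
  split_ifs <;> simp

theorem altSum_mul_single {c : Fin N → ℕ} {σ : Equiv.Perm (Fin N)} (h : σ ∈ labelStab c) :
    altSum c * MonoidAlgebra.single σ 1 = ((Equiv.Perm.sign σ : ℤ) : ℂ) • altSum c := by
  rw [← invMap_invMap (altSum c * _), invMap_mul, invMap_altSum, invMap_single,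
    single_mul_altSum ((labelStab c).inv_mem h), invMap_smul, invMap_altSum, Equiv.Perm.sign_inv]

/-- The sum absorbs each of its terms, so n is the order of the stabilizer. -/
theorem symSum_mul_symSum (r : Fin N → ℕ) :
    ∃ n : ℕ, n ≠ 0 ∧ symSum r * symSum r = (n : ℂ) • symSum r := by
  classical
  refine ⟨(Finset.univ.filter fun σ => σ ∈ labelStab r).card, ?_, ?_⟩
  · exact Finset.card_ne_zero_of_mem (Finset.mem_filter.2 ⟨Finset.mem_univ _, one_mem _⟩)
  · conv_lhs => enter [1]; rw [symSum]
    rw [Finset.sum_mul, Finset.card_filter, Nat.cast_sum, Finset.sum_smul]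
    refine Finset.sum_congr rfl fun σ _ => ?_
    by_cases h : σ ∈ labelStab r
    · rw [if_pos h, if_pos (mem_labelStab.1 h), MonoidAlgebra.of_apply, single_mul_symSum h]
      simp
    · rw [if_neg h, if_neg (mt mem_labelStab.2 h)]
      simp

theorem altSum_mul_altSum (c : Fin N → ℕ) :
    ∃ n : ℕ, n ≠ 0 ∧ altSum c * altSum c = (n : ℂ) • altSum c := by
  classical
  refine ⟨(Finset.univ.filter fun σ => σ ∈ labelStab c).card, ?_, ?_⟩
  · exact Finset.card_ne_zero_of_mem (Finset.mem_filter.2 ⟨Finset.mem_univ _, one_mem _⟩)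
  · conv_lhs => enter [1]; rw [altSum]
    rw [Finset.sum_mul, Finset.card_filter, Nat.cast_sum, Finset.sum_smul]
    refine Finset.sum_congr rfl fun σ _ => ?_
    by_cases h : σ ∈ labelStab c
    · rw [if_pos h, if_pos (mem_labelStab.1 h), MonoidAlgebra.of_apply, smul_mul_assoc,
        single_mul_altSum h, smul_smul]
      congr 1
      rcases Int.units_eq_one_or (Equiv.Perm.sign σ) with h | h <;> simp [h]
    · rw [if_neg h, if_neg (mt mem_labelStab.2 h)]
      simp

/-- Von Neumann's lemma: two elements in the same row and, after moving by `g`, in the same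
column kill the product. -/
theorem symSum_mul_single_mul_altSum_eq_zero {r c : Fin N → ℕ} {g : Equiv.Perm (Fin N)}
    {x y : Fin N} (hxy : x ≠ y) (hr : r x = r y) (hc : c (g⁻¹ x) = c (g⁻¹ y)) :
    symSum r * MonoidAlgebra.single g 1 * altSum c = 0 := by
  -- A transposition split off from the row sum passes through g and is absorbed by the column sum
  -- with sign -1, so the product equals its negative.
  have hs : Equiv.swap x y * g = g * Equiv.swap (g⁻¹ x) (g⁻¹ y) := by
    rw [Equiv.mul_swap_eq_swap_mul, show g (g⁻¹ x) = x from g.apply_symm_apply x,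
      show g (g⁻¹ y) = y from g.apply_symm_apply y]
  have h1 : symSum r * MonoidAlgebra.single g 1 * altSum c
      = -(symSum r * MonoidAlgebra.single g 1 * altSum c) := by
    conv_lhs => rw [← symSum_mul_single (swap_mem_labelStab hr)]
    rw [mul_assoc (symSum r), MonoidAlgebra.single_mul_single, hs, ← MonoidAlgebra.single_mul_single,
      ← mul_assoc, mul_assoc _ _ (altSum c), single_mul_altSum (swap_mem_labelStab hc),
      Equiv.Perm.sign_swap (fun h => hxy (g⁻¹.injective h))]
    simp
  have h2 : (2 : ℂ) • (symSum r * MonoidAlgebra.single g 1 * altSum c) = 0 := by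
    rw [two_smul]
    exact eq_neg_iff_add_eq_zero.1 h1
  exact (smul_eq_zero.1 h2).resolve_left two_ne_zero

end Symmetrizers

/-! ### Fillings of Young diagrams -/

section Fillings

variable {N : ℕ} {μ : YoungDiagram}

/-- The row of an entry of a filling. -/
def rowOf (f : μ.cells ≃ Fin N) (x : Fin N) : ℕ := (f.symm x).1.1

/-- The column of an entry of a filling. -/
def colOf (f : μ.cells ≃ Fin N) (x : Fin N) : ℕ := (f.symm x).1.2

theorem rowOf_colOf_mem (f : μ.cells ≃ Fin N) (x : Fin N) : (rowOf f x, colOf f x) ∈ μ :=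
  (YoungDiagram.mem_cells _).1 (f.symm x).2

theorem eq_of_rowOf_colOf (f : μ.cells ≃ Fin N) {x y : Fin N} (hr : rowOf f x = rowOf f y)
    (hc : colOf f x = colOf f y) : x = y :=
  f.symm.injective (Subtype.ext (Prod.ext hr hc))

theorem card_filter_filling (f : μ.cells ≃ Fin N) (p : ℕ → ℕ → Prop) [∀ i j, Decidable (p i j)] :
    (Finset.univ.filter fun x => p (rowOf f x) (colOf f x)).card
      = (μ.cells.filter fun c => p c.1 c.2).card := by
  refine Finset.card_bij (fun x _ => (f.symm x).1) ?_ ?_ ?_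
  · intro x hx
    exact Finset.mem_filter.2 ⟨(f.symm x).2, (Finset.mem_filter.1 hx).2⟩
  · intro x _ y _ h
    exact f.symm.injective (Subtype.ext h)
  · intro c hc
    obtain ⟨h1, h2⟩ := Finset.mem_filter.1 hc
    exact ⟨f ⟨c, h1⟩, Finset.mem_filter.2 ⟨Finset.mem_univ _, by simpa [rowOf, colOf] using h2⟩,
      by simp⟩

/-! ### Dominance of shapes, by counting boxes column by column. -/

theorem card_colOf_eq (f : μ.cells ≃ Fin N) (j : ℕ) :
    (Finset.univ.filter fun x => colOf f x = j).card = μ.colLen j := by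
  rw [card_filter_filling f fun _ j' => j' = j, YoungDiagram.colLen_eq_card]
  rfl

theorem card_rowOf_eq (f : μ.cells ≃ Fin N) (i : ℕ) :
    (Finset.univ.filter fun x => rowOf f x = i).card = μ.rowLen i := by
  rw [card_filter_filling f fun i' _ => i' = i, YoungDiagram.rowLen_eq_card]
  rfl

theorem card_rowOf_lt_colOf_eq (f : μ.cells ≃ Fin N) (m j : ℕ) :
    (Finset.univ.filter fun x => rowOf f x < m ∧ colOf f x = j).card = min m (μ.colLen j) := by
  rw [card_filter_filling f fun i' j' => i' < m ∧ j' = j]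
  have : (μ.cells.filter fun c => c.1 < m ∧ c.2 = j)
      = (Finset.range (min m (μ.colLen j))).map ⟨fun i => (i, j), fun a b h => by simpa using h⟩ := by
    ext ⟨a, b⟩
    simp only [Finset.mem_filter, YoungDiagram.mem_cells, Finset.mem_map, Finset.mem_range,
      lt_min_iff]
    constructor
    · rintro ⟨h, h', rfl⟩
      exact ⟨a, ⟨h', YoungDiagram.mem_iff_lt_colLen.1 h⟩, rfl⟩
    · rintro ⟨_, ⟨h, h'⟩, hab⟩
      cases hab
      exact ⟨YoungDiagram.mem_iff_lt_colLen.2 h', h, rfl⟩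
  rw [this, Finset.card_map, Finset.card_range]

theorem card_rowOf_lt (f : μ.cells ≃ Fin N) (m : ℕ) :
    (Finset.univ.filter fun x => rowOf f x < m).card = ∑ i ∈ Finset.range m, μ.rowLen i := by
  rw [Finset.card_eq_sum_card_fiberwise (f := rowOf f) (t := Finset.range m)]
  · refine Finset.sum_congr rfl fun i hi => ?_
    rw [← card_rowOf_eq f, Finset.filter_filter]
    congr 1
    ext x
    simp only [Finset.mem_filter, Finset.mem_univ, true_and, and_iff_right_iff_imp]
    rintro rfl
    exact Finset.mem_range.1 hi
  · intro x hx
    simpa using hx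

/-- On a column of f the labels r are distinct, so at most m of them are below m. By
`card_rowOf_lt_colOf_eq` the bound is attained by the rows of f itself; comparing the two gives
dominance. -/
theorem card_lt_fiber_le (f : μ.cells ≃ Fin N) {r : Fin N → ℕ}
    (hinj : ∀ x y, r x = r y → colOf f x = colOf f y → x = y) (m j : ℕ) :
    (Finset.univ.filter fun x => r x < m ∧ colOf f x = j).card ≤ min m (μ.colLen j) := by
  refine le_min ?_ ?_
  · rw [← Finset.card_range m]
    refine Finset.card_le_card_of_injOn r ?_ ?_
    · intro x hx
      simpa using (Finset.mem_filter.1 (Finset.mem_coe.1 hx)).2.1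
    · intro x hx y hy h
      exact hinj x y h ((Finset.mem_filter.1 (Finset.mem_coe.1 hx)).2.2.trans
        (Finset.mem_filter.1 (Finset.mem_coe.1 hy)).2.2.symm)
  · rw [← card_colOf_eq f]
    exact Finset.card_le_card fun x hx => by
      simpa using (Finset.mem_filter.1 hx).2.2

theorem card_lt_eq_sum (f : μ.cells ≃ Fin N) (r : Fin N → ℕ) (m : ℕ) :
    (Finset.univ.filter fun x => r x < m).card
      = ∑ j ∈ Finset.univ.image (colOf f),
        (Finset.univ.filter fun x => r x < m ∧ colOf f x = j).card := by
  rw [Finset.card_eq_sum_card_fiberwise (f := colOf f) (t := Finset.univ.image (colOf f))]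
  · simp only [Finset.filter_filter]
  · intro x _
    simp

/-- If elements in the same row of a filling of `ν` lie in different columns of a filling of `μ`,
then `μ` dominates `ν`. -/
theorem sum_rowLen_le {ν : YoungDiagram} (f : ν.cells ≃ Fin N) (f' : μ.cells ≃ Fin N)
    (hinj : ∀ x y, rowOf f x = rowOf f y → colOf f' x = colOf f' y → x = y) (m : ℕ) :
    ∑ i ∈ Finset.range m, ν.rowLen i ≤ ∑ i ∈ Finset.range m, μ.rowLen i := by
  rw [← card_rowOf_lt f, ← card_rowOf_lt f', card_lt_eq_sum f', card_lt_eq_sum f']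
  refine Finset.sum_le_sum fun j _ => ?_
  rw [card_rowOf_lt_colOf_eq]
  exact card_lt_fiber_le f' hinj m j

/-- For equal shapes the columnwise inequalities behind `sum_rowLen_le` have equal totals, so each
is an equality. Between m = row of x and m + 1 the count min m (column length) grows, because x is
counted; hence the row of x is less than the column length. -/
theorem rowOf_colOf_mem_of_injective (f f' : μ.cells ≃ Fin N)
    (hinj : ∀ x y, rowOf f x = rowOf f y → colOf f' x = colOf f' y → x = y) (x : Fin N) :
    (rowOf f x, colOf f' x) ∈ μ := by
  have key : ∀ m, (Finset.univ.filter fun y => rowOf f y < m ∧ colOf f' y = colOf f' x).card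
      = min m (μ.colLen (colOf f' x)) := by
    intro m
    have h1 := card_rowOf_lt f m
    rw [← card_rowOf_lt f', card_lt_eq_sum f', card_lt_eq_sum f'] at h1
    simp only [card_rowOf_lt_colOf_eq] at h1
    exact (Finset.sum_eq_sum_iff_of_le fun j _ => card_lt_fiber_le f' hinj m j).1 h1 _
      (Finset.mem_image_of_mem _ (Finset.mem_univ x))
  have h0 := key (rowOf f x)
  have h1 := key (rowOf f x + 1)
  have hlt : (Finset.univ.filter fun y => rowOf f y < rowOf f x ∧ colOf f' y = colOf f' x).card
      < (Finset.univ.filter fun y => rowOf f y < rowOf f x + 1 ∧ colOf f' y = colOf f' x).card := by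
    refine Finset.card_lt_card (Finset.ssubset_iff_of_subset ?_ |>.2 ⟨x, ?_, ?_⟩)
    · intro y hy
      simp only [Finset.mem_filter, Finset.mem_univ, true_and] at hy ⊢
      exact ⟨by omega, hy.2⟩
    · simp
    · simp
  rw [YoungDiagram.mem_iff_lt_colLen]
  omega

theorem eq_of_sum_rowLen_eq {ν : YoungDiagram}
    (h : ∀ m, ∑ i ∈ Finset.range m, ν.rowLen i = ∑ i ∈ Finset.range m, μ.rowLen i) : ν = μ := by
  have h' : ∀ i, ν.rowLen i = μ.rowLen i := by
    intro i
    have h1 := h (i + 1)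
    rw [Finset.sum_range_succ, Finset.sum_range_succ, h i] at h1
    omega
  ext ⟨i, j⟩
  rw [YoungDiagram.mem_cells, YoungDiagram.mem_cells, YoungDiagram.mem_iff_lt_rowLen,
    YoungDiagram.mem_iff_lt_rowLen, h']

/-- Placing x in its own row and in the column of g⁻¹x is a bijection h onto the boxes. It is a
third filling, which shares its rows with f and its columns with the translate of f by g; p carries
f to h and p⁻¹g is then a column permutation of f. -/
theorem exists_eq_mul_of_injective (f : μ.cells ≃ Fin N) (g : Equiv.Perm (Fin N))
    (hinj : ∀ x y, rowOf f x = rowOf f y → colOf f (g⁻¹ x) = colOf f (g⁻¹ y) → x = y) :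
    ∃ p ∈ labelStab (rowOf f), ∃ q ∈ labelStab (colOf f), g = p * q := by
  have hmem := rowOf_colOf_mem_of_injective f (f.trans g) hinj
  let h : Fin N → μ.cells := fun x => ⟨(rowOf f x, colOf f (g⁻¹ x)), hmem x⟩
  have hb : Function.Bijective h := by
    rw [Fintype.bijective_iff_injective_and_card]
    refine ⟨fun x y hxy => ?_, (Fintype.card_congr f).symm⟩
    have := Prod.ext_iff.1 (Subtype.ext_iff.1 hxy)
    exact hinj x y this.1 this.2
  let e := Equiv.ofBijective h hb
  let p : Equiv.Perm (Fin N) := f.symm.trans e.symm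
  have hp : ∀ x, h (p x) = f.symm x := fun x => e.apply_symm_apply _
  have hp' : ∀ y, f.symm (p⁻¹ y) = h y := fun y => by
    rw [← hp, show p (p⁻¹ y) = y from p.apply_symm_apply y]
  refine ⟨p, fun x => ?_, p⁻¹ * g, fun x => ?_, by group⟩
  · have : rowOf f (p x) = (h (p x)).1.1 := rfl
    rw [this, hp]
    rfl
  · have h1 : colOf f ((p⁻¹ * g) x) = (f.symm (p⁻¹ (g x))).1.2 := rfl
    have h2 : (h (g x)).1.2 = colOf f (g.symm (g x)) := rfl
    rw [h1, hp', h2, Equiv.symm_apply_apply]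

theorem eq_one_of_mem_labelStab (f : μ.cells ≃ Fin N) {p q : Equiv.Perm (Fin N)}
    (hp : p ∈ labelStab (rowOf f)) (hq : q ∈ labelStab (colOf f)) (h : p * q = 1) : q = 1 := by
  ext1 x
  refine eq_of_rowOf_colOf f ?_ (hq x)
  rw [← hp (q x), ← Equiv.Perm.mul_apply, h]

/-- For a group element g, either g = pq and both factors are absorbed up to the sign of q, or two
entries of one row collide in a column and von Neumann's lemma gives 0. -/
theorem symSum_mul_mul_altSum (f : μ.cells ≃ Fin N)
    (x : MonoidAlgebra ℂ (Equiv.Perm (Fin N))) :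
    ∃ s : ℂ, symSum (rowOf f) * x * altSum (colOf f)
      = s • (symSum (rowOf f) * altSum (colOf f)) := by
  induction x using MonoidAlgebra.induction_linear with
  | zero => exact ⟨0, by simp⟩
  | add x y hx hy =>
    obtain ⟨s, hs⟩ := hx
    obtain ⟨t, ht⟩ := hy
    exact ⟨s + t, by rw [mul_add, add_mul, hs, ht, add_smul]⟩
  | single g a =>
    have ha : MonoidAlgebra.single g a = a • MonoidAlgebra.single g (1 : ℂ) := by simp
    rw [ha, mul_smul_comm, smul_mul_assoc]
    by_cases hinj : ∀ x y, rowOf f x = rowOf f y → colOf f (g⁻¹ x) = colOf f (g⁻¹ y) → x = y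
    · obtain ⟨p, hp, q, hq, rfl⟩ := exists_eq_mul_of_injective f g hinj
      refine ⟨a * ((Equiv.Perm.sign q : ℤ) : ℂ), ?_⟩
      rw [← one_mul (1 : ℂ), ← MonoidAlgebra.single_mul_single, ← mul_assoc, symSum_mul_single hp,
        mul_assoc, single_mul_altSum hq, mul_smul_comm, smul_smul]
    · push Not at hinj
      obtain ⟨x, y, h1, h2, h3⟩ := hinj
      exact ⟨0, by rw [symSum_mul_single_mul_altSum_eq_zero h3 h1 h2, smul_zero, zero_smul]⟩

/-- A group element without a colliding pair would make μ dominate ν, contrary to the partial sums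
at m. -/
theorem symSum_mul_mul_altSum_eq_zero {ν : YoungDiagram} (f : ν.cells ≃ Fin N)
    (f' : μ.cells ≃ Fin N) (m : ℕ)
    (hm : ∑ i ∈ Finset.range m, μ.rowLen i < ∑ i ∈ Finset.range m, ν.rowLen i)
    (x : MonoidAlgebra ℂ (Equiv.Perm (Fin N))) :
    symSum (rowOf f) * x * altSum (colOf f') = 0 := by
  induction x using MonoidAlgebra.induction_linear with
  | zero => simp
  | add x y hx hy => rw [mul_add, add_mul, hx, hy, add_zero]
  | single g a =>
    have ha : MonoidAlgebra.single g a = a • MonoidAlgebra.single g (1 : ℂ) := by simp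
    rw [ha, mul_smul_comm, smul_mul_assoc]
    by_cases hinj : ∀ x y, rowOf f x = rowOf f y → colOf f' (g⁻¹ x) = colOf f' (g⁻¹ y) → x = y
    · exact absurd (sum_rowLen_le f (f'.trans g) hinj m) (not_le.2 hm)
    · push Not at hinj
      obtain ⟨x, y, h1, h2, h3⟩ := hinj
      rw [symSum_mul_single_mul_altSum_eq_zero h3 h1 h2, smul_zero]

/-! ### Young symmetrizers: orthogonality and quasi-idempotence. -/

/-- The Young symmetrizer of a filling. -/
noncomputable def youngSym (f : μ.cells ≃ Fin N) : MonoidAlgebra ℂ (Equiv.Perm (Fin N)) :=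
  symSum (rowOf f) * altSum (colOf f)

theorem conjMap_youngSym (f : μ.cells ≃ Fin N) : conjMap (youngSym f) = youngSym f := by
  rw [youngSym, map_mul, conjMap_symSum, conjMap_altSum]

theorem youngSym_mul_mul_youngSym_of_ne {ν : YoungDiagram} (f : ν.cells ≃ Fin N)
    (f' : μ.cells ≃ Fin N) (h : ν ≠ μ) (x : MonoidAlgebra ℂ (Equiv.Perm (Fin N))) :
    youngSym f * x * youngSym f' = 0 := by
  have : ∃ m, ∑ i ∈ Finset.range m, ν.rowLen i ≠ ∑ i ∈ Finset.range m, μ.rowLen i := by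
    by_contra! h'
    exact h (eq_of_sum_rowLen_eq h')
  obtain ⟨m, hm⟩ := this
  rcases lt_or_gt_of_ne hm with hm | hm
  · have h1 := congrArg invMap (symSum_mul_mul_altSum_eq_zero f' f m hm (invMap x))
    rw [invMap_mul, invMap_mul, invMap_symSum, invMap_altSum, invMap_invMap, invMap_zero,
      ← mul_assoc] at h1
    have : youngSym f * x * youngSym f' = symSum (rowOf f)
        * (altSum (colOf f) * x * symSum (rowOf f')) * altSum (colOf f') := by
      simp only [youngSym, mul_assoc]
    rw [this, h1, mul_zero, zero_mul]
  · have : youngSym f * x * youngSym f' = symSum (rowOf f)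
        * (altSum (colOf f) * x * symSum (rowOf f')) * altSum (colOf f') := by
      simp only [youngSym, mul_assoc]
    rw [this, symSum_mul_mul_altSum_eq_zero f f' m hm]

/-- A row permutation and a column permutation with product 1 are both trivial. -/
theorem coeff_youngSym_one (f : μ.cells ≃ Fin N) : (youngSym f).coeff 1 = 1 := by
  classical
  rw [youngSym, coeff_mul_eq_sum, Finset.sum_eq_single 1]
  · simp [coeff_symSum, coeff_altSum, one_mem]
  · intro p _ hp
    rw [coeff_symSum, coeff_altSum]
    split_ifs with h1 h2
    · refine absurd (eq_one_of_mem_labelStab f h1 h2 (by simp)) ?_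
      simpa using hp
    all_goals simp
  · simp

/-- Reality of n is read off at the identity, where c = ab has coefficient 1. If n were 0, the real
self-adjoint element aba would have square 0, hence vanish by positivity; then (ab)(ab)^* = abba is
a multiple of aba and vanishes, so ab = 0, against its coefficient 1. -/
theorem youngSym_mul_self (f : μ.cells ≃ Fin N) :
    ∃ n : ℝ, n ≠ 0 ∧ youngSym f * youngSym f = (n : ℂ) • youngSym f := by
  obtain ⟨n, hn⟩ := symSum_mul_mul_altSum f (altSum (colOf f) * symSum (rowOf f))
  have hn' : youngSym f * youngSym f = n • youngSym f := by
    rw [youngSym, ← hn]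
    simp only [mul_assoc]
  have hc : (starRingEnd ℂ) n = n := by
    have h1 := congrArg conjMap hn'
    rw [map_mul, conjMap_smul, conjMap_youngSym, hn'] at h1
    have h2 := congrArg (fun x => MonoidAlgebra.coeff x 1) h1
    simpa [coeff_youngSym_one] using h2.symm
  obtain ⟨n', rfl⟩ := Complex.conj_eq_iff_real.1 hc
  refine ⟨n', ?_, hn'⟩
  rintro rfl
  obtain ⟨m, hm0, hm⟩ := symSum_mul_symSum (rowOf f)
  obtain ⟨l, hl0, hl⟩ := altSum_mul_altSum (colOf f)
  set a := symSum (rowOf f)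
  set b := altSum (colOf f)
  have hinv : invMap (a * b * a) = a * b * a := by
    rw [invMap_mul, invMap_mul, invMap_symSum, invMap_altSum, mul_assoc]
  have hreal : conjMap (a * b * a) = a * b * a := by
    rw [map_mul, map_mul, conjMap_symSum, conjMap_altSum]
  have hzero : a * b * a * (a * b * a) = 0 := by
    have : a * b * a * (a * b * a) = a * b * (a * a) * b * a := by simp only [mul_assoc]
    rw [this, hm]
    have h2 : a * b * (a * b) = 0 := by simpa [youngSym] using hn'
    have h3 : a * b * (m : ℂ) • a * b * a = (m : ℂ) • (a * b * (a * b) * a) := by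
      simp only [mul_smul_comm, smul_mul_assoc, mul_assoc]
    rw [h3, h2, zero_mul, smul_zero]
  have haba : a * b * a = 0 := by
    by_contra h
    refine invMap_mul_self_coeff_ne_zero hreal h ?_
    rw [hinv, hzero]
    simp
  have hab : a * b = 0 := by
    by_contra h
    refine invMap_mul_self_coeff_ne_zero (x := invMap (a * b)) ?_ ?_ ?_
    · rw [conjMap_invMap]
      exact congrArg invMap (conjMap_youngSym f)
    · intro h'
      apply h
      rw [← invMap_invMap (a * b), h', invMap_zero]
    · rw [invMap_invMap, invMap_mul, invMap_symSum, invMap_altSum]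
      have : a * b * (b * a) = (l : ℂ) • (a * b * a) := by
        rw [mul_assoc, ← mul_assoc b, hl]
        simp only [mul_smul_comm, smul_mul_assoc, mul_assoc]
      rw [this, haba]
      simp
  have h1 := coeff_youngSym_one f
  rw [youngSym, hab] at h1
  simp at h1

/-- The product `x^* y` of two elements of the left ideal of a Young symmetrizer is determined by
their scalar product. -/
theorem invMap_mul_of_mem (f : μ.cells ≃ Fin N) (u v : MonoidAlgebra ℂ (Equiv.Perm (Fin N))) :
    (∑ g, (youngSym f).coeff g * (youngSym f).coeff g)
        • (invMap (u * youngSym f) * (v * youngSym f))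
      = (∑ g, (u * youngSym f).coeff g * (v * youngSym f).coeff g)
        • (invMap (youngSym f) * youngSym f) := by
  rw [← coeff_invMap_mul_one, ← coeff_invMap_mul_one]
  -- Since c^* = ba, every c^* x c = b(axa)b lies on the line spanned by bab, so two such elements
  -- are compared through their coefficients at 1.
  have key : ∀ x, ∃ s : ℂ, invMap (youngSym f) * x * youngSym f
      = s • (altSum (colOf f) * symSum (rowOf f) * altSum (colOf f)) := by
    intro x
    obtain ⟨s, hs⟩ := symSum_mul_mul_altSum f (x * symSum (rowOf f))
    refine ⟨s, ?_⟩
    rw [mul_assoc (altSum (colOf f)), ← mul_smul_comm, ← hs, youngSym, invMap_mul, invMap_symSum,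
      invMap_altSum]
    simp only [mul_assoc]
  obtain ⟨s, hs⟩ := key (invMap u * v)
  obtain ⟨t, ht⟩ := key 1
  rw [mul_one] at ht
  have hs' : invMap (u * youngSym f) * (v * youngSym f)
      = s • (altSum (colOf f) * symSum (rowOf f) * altSum (colOf f)) := by
    rw [← hs, invMap_mul]
    simp only [mul_assoc]
  rw [hs', ht]
  simp only [MonoidAlgebra.coeff_smul_apply, smul_smul, smul_eq_mul]
  congr 1
  ring

end Fillings

/-! ### Completeness of the Young symmetrizers -/

section Completeness

variable {N : ℕ}

/-- The Young diagrams with `N` boxes. -/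
abbrev Diagrams (N : ℕ) : Type := {μ : YoungDiagram // μ.card = N}

/-- A filling of a diagram with `N` boxes. -/
noncomputable def diagFilling (μ : Diagrams N) : μ.1.cells ≃ Fin N :=
  Finset.equivFinOfCardEq μ.2

/-- The Young symmetrizer of a diagram. -/
noncomputable def diagSym (μ : Diagrams N) : MonoidAlgebra ℂ (Equiv.Perm (Fin N)) :=
  youngSym (diagFilling μ)

/-- The central element obtained by averaging the Young symmetrizer of a diagram. -/
noncomputable def centralSym (μ : Diagrams N) : MonoidAlgebra ℂ (Equiv.Perm (Fin N)) :=
  classSum (diagSym μ)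

theorem conjMap_centralSym (μ : Diagrams N) : conjMap (centralSym μ) = centralSym μ :=
  conjMap_classSum (conjMap_youngSym _)

theorem centralSym_comm (μ : Diagrams N) (x : MonoidAlgebra ℂ (Equiv.Perm (Fin N))) :
    centralSym μ * x = x * centralSym μ := by
  induction x using MonoidAlgebra.induction_linear with
  | zero => simp
  | add x y hx hy => rw [mul_add, add_mul, hx, hy]
  | single g a =>
    ext h
    rw [MonoidAlgebra.coeff_mul_single_apply, MonoidAlgebra.coeff_single_mul_apply, mul_comm a,
      centralSym, ← coeff_classSum_conj _ (h * g⁻¹) g⁻¹]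
    simp [mul_assoc]

/-- A permutation and its inverse have the same cycle type, hence are conjugate. -/
theorem invMap_centralSym (μ : Diagrams N) : invMap (centralSym μ) = centralSym μ := by
  ext g
  rw [coeff_invMap]
  have : IsConj g g⁻¹ := by
    rw [Equiv.Perm.isConj_iff_cycleType_eq, Equiv.Perm.cycleType_inv]
  obtain ⟨h, hh⟩ := isConj_iff.1 this
  rw [← hh, centralSym, coeff_classSum_conj]

theorem centralSym_mul_mul_diagSym {μ ν : Diagrams N} (h : μ ≠ ν)
    (x : MonoidAlgebra ℂ (Equiv.Perm (Fin N))) : centralSym μ * x * diagSym ν = 0 := by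
  rw [centralSym, classSum, Finset.sum_mul, Finset.sum_mul]
  refine Finset.sum_eq_zero fun g _ => ?_
  have h1 := youngSym_mul_mul_youngSym_of_ne (diagFilling μ) (diagFilling ν)
    (fun h' => h (Subtype.ext h')) (MonoidAlgebra.single g⁻¹ 1 * x)
  rw [mul_assoc (MonoidAlgebra.single g 1), mul_assoc, mul_assoc, mul_assoc]
  rw [mul_assoc, mul_assoc] at h1
  exact (congrArg (MonoidAlgebra.single g 1 * ·) h1).trans (mul_zero _)

theorem centralSym_mul_centralSym {μ ν : Diagrams N} (h : μ ≠ ν) :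
    centralSym μ * centralSym ν = 0 := by
  conv_lhs => rw [centralSym.eq_def ν, classSum]
  rw [Finset.mul_sum]
  refine Finset.sum_eq_zero fun g _ => ?_
  rw [← mul_assoc, ← mul_assoc, centralSym_mul_mul_diagSym h, zero_mul]

/-- The coefficient at 1 is the order of the group. -/
theorem centralSym_ne_zero (μ : Diagrams N) : centralSym μ ≠ 0 := by
  intro h
  have h1 := coeff_classSum (diagSym μ) 1
  rw [← centralSym, h] at h1
  simp only [diagSym, mul_one, inv_mul_cancel, coeff_youngSym_one, Finset.sum_const,
    Finset.card_univ, MonoidAlgebra.coeff_zero, Finsupp.coe_zero, Pi.zero_apply,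
    nsmul_eq_mul] at h1
  exact Nat.cast_ne_zero.2 Fintype.card_ne_zero h1.symm

theorem centralSym_mul_self_ne_zero (μ : Diagrams N) : centralSym μ * centralSym μ ≠ 0 := by
  intro h
  refine invMap_mul_self_coeff_ne_zero (conjMap_centralSym μ) (centralSym_ne_zero μ) ?_
  rw [invMap_centralSym, h]
  simp

/-- The values of an element of the group algebra on representatives of the conjugacy classes. -/
noncomputable def classValues (G : Type*) [Group G] :
    MonoidAlgebra ℂ G →ₗ[ℂ] (ConjClasses G → ℂ) where
  toFun x q := x.coeff (Quotient.out q)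
  map_add' x y := by ext q; simp
  map_smul' r x := by ext q; simp

theorem eq_of_classValues_eq {G : Type*} [Group G] {x y : MonoidAlgebra ℂ G}
    (hx : ∀ g, x * MonoidAlgebra.single g 1 = MonoidAlgebra.single g 1 * x)
    (hy : ∀ g, y * MonoidAlgebra.single g 1 = MonoidAlgebra.single g 1 * y)
    (h : classValues G x = classValues G y) : x = y := by
  have key : ∀ z : MonoidAlgebra ℂ G,
      (∀ g, z * MonoidAlgebra.single g 1 = MonoidAlgebra.single g 1 * z) →
      ∀ g, classValues G z (ConjClasses.mk g) = z.coeff g := by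
    intro z hz g
    obtain ⟨a, ha⟩ := isConj_iff.1
      (Quotient.mk_out (s := IsConj.setoid G) g : IsConj _ g)
    have := congrArg (fun w => MonoidAlgebra.coeff w (g * a)) (hz a)
    simp only [MonoidAlgebra.coeff_mul_single_apply, MonoidAlgebra.coeff_single_mul_apply] at this
    rw [mul_one, one_mul, mul_inv_cancel_right] at this
    rw [this]
    change z.coeff (Quotient.out (Quotient.mk (IsConj.setoid G) g)) = _
    generalize Quotient.out (Quotient.mk (IsConj.setoid G) g) = o at ha
    subst ha
    refine congrArg z.coeff ?_
    group
  ext g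
  rw [← key x hx, ← key y hy, h]

/-- Multiplying a relation by one central element isolates its coefficient, by orthogonality and the
non-vanishing of squares. Central elements lose nothing on passing to class representatives.
Finiteness of `Diagrams N` is a consequence. -/
theorem linearIndependent_classValues :
    LinearIndependent ℂ fun μ : Diagrams N => classValues _ (centralSym μ) := by
  rw [linearIndependent_iff']
  intro s w h μ hμ
  simp only [← map_smul] at h
  rw [← map_sum, ← map_zero (classValues (Equiv.Perm (Fin N)))] at h
  have h1 := eq_of_classValues_eq (fun g => ?_) (fun g => by simp) h
  · have h2 := congrArg (· * centralSym μ) h1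
    simp only [zero_mul] at h2
    rw [Finset.sum_mul, Finset.sum_eq_single μ] at h2
    · rw [smul_mul_assoc] at h2
      exact (smul_eq_zero.1 h2).resolve_right (centralSym_mul_self_ne_zero μ)
    · intro ν _ hν
      rw [smul_mul_assoc, centralSym_mul_centralSym hν, smul_zero]
    · exact fun h => absurd hμ h
  · rw [Finset.sum_mul, Finset.mul_sum]
    simp only [smul_mul_assoc, mul_smul_comm, centralSym_comm]

instance : Finite (Diagrams N) := by
  have : Finite (ConjClasses (Equiv.Perm (Fin N))) := Quotient.finite _
  exact linearIndependent_classValues.finite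

/-! ### Counting diagrams against conjugacy classes, and the decomposition of 1. -/

theorem card_eq_sum_rowLens (μ : YoungDiagram) : μ.card = μ.rowLens.sum := by
  have h := card_rowOf_lt (Finset.equivFinOfCardEq (rfl : μ.cells.card = μ.card)) (μ.colLen 0)
  rw [Finset.filter_true_of_mem, Finset.card_univ, Fintype.card_fin] at h
  · rw [YoungDiagram.card, h, YoungDiagram.rowLens, Finset.sum_eq_multiset_sum]
    rfl
  · intro x _
    rw [← YoungDiagram.mem_iff_lt_colLen]
    exact μ.up_left_mem le_rfl (Nat.zero_le _) (rowOf_colOf_mem _ x)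

/-- The Young diagram of a partition. -/
noncomputable def diagramOfPartition (p : N.Partition) : Diagrams N :=
  ⟨YoungDiagram.ofRowLens (p.parts.sort (· ≥ ·)) (Multiset.pairwise_sort _ _).sortedGE, by
    rw [card_eq_sum_rowLens, YoungDiagram.rowLens_ofRowLens_eq_self, ← Multiset.sum_coe,
      Multiset.sort_eq, p.parts_sum]
    intro x hx
    exact p.parts_pos ((Multiset.mem_sort _).1 hx)⟩

theorem diagramOfPartition_injective :
    Function.Injective (diagramOfPartition : N.Partition → Diagrams N) := by
  intro p q h
  have h1 := congrArg (fun μ : Diagrams N => μ.1.rowLens) h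
  simp only [diagramOfPartition] at h1
  rw [YoungDiagram.rowLens_ofRowLens_eq_self, YoungDiagram.rowLens_ofRowLens_eq_self] at h1
  · apply Nat.Partition.ext
    rw [← Multiset.sort_eq p.parts (· ≥ ·), h1, Multiset.sort_eq]
  · exact fun x hx => q.parts_pos ((Multiset.mem_sort _).1 hx)
  · exact fun x hx => p.parts_pos ((Multiset.mem_sort _).1 hx)

/-- Cycle type embeds classes into partitions, and partitions embed into diagrams. -/
theorem card_conjClasses_le :
    Nat.card (ConjClasses (Equiv.Perm (Fin N))) ≤ Nat.card (Diagrams N) := by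
  have hN : Fintype.card (Fin N) = N := Fintype.card_fin N
  let F : ConjClasses (Equiv.Perm (Fin N)) → (Fintype.card (Fin N)).Partition :=
    Quotient.lift Equiv.Perm.partition fun _ _ h => Equiv.Perm.partition_eq_of_isConj.1 h
  have hF : Function.Injective F := by
    intro a b
    induction a using Quotient.inductionOn
    induction b using Quotient.inductionOn
    intro h
    exact Quotient.sound (Equiv.Perm.partition_eq_of_isConj.2 h)
  refine (Nat.card_le_card_of_injective F hF).trans ?_
  rw [hN]
  exact Nat.card_le_card_of_injective _ diagramOfPartition_injective

/-- The central elements of the Young symmetrizers span a space that contains `1`. -/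
theorem exists_sum_centralSym_eq_one :
    ∃ w : Diagrams N → ℂ, ∑ᶠ μ, w μ • centralSym μ = 1 := by
  classical
  have := Fintype.ofFinite (Diagrams N)
  have : Finite (ConjClasses (Equiv.Perm (Fin N))) := Quotient.finite _
  have := Fintype.ofFinite (ConjClasses (Equiv.Perm (Fin N)))
  have hli := linearIndependent_classValues (N := N)
  -- Independence bounds the number of diagrams by the number of classes; with the opposite
  -- inequality the family is a basis of all functions on classes.
  have hspan := hli.span_eq_top_of_card_eq_finrank' (le_antisymm hli.fintype_card_le_finrank (by
    rw [Module.finrank_fintype_fun_eq_card, ← Nat.card_eq_fintype_card, ← Nat.card_eq_fintype_card]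
    exact card_conjClasses_le))
  have h1 : classValues _ (1 : MonoidAlgebra ℂ (Equiv.Perm (Fin N))) ∈ Submodule.span ℂ
      (Set.range fun μ : Diagrams N => classValues _ (centralSym μ)) := by
    rw [hspan]
    trivial
  obtain ⟨w, hw⟩ := (Submodule.mem_span_range_iff_exists_fun ℂ).1 h1
  refine ⟨w, ?_⟩
  rw [finsum_eq_sum_of_fintype]
  simp only [← map_smul] at hw
  rw [← map_sum] at hw
  refine eq_of_classValues_eq (fun g => ?_) (fun g => by simp) hw
  rw [Finset.sum_mul, Finset.mul_sum]
  simp only [smul_mul_assoc, mul_smul_comm, centralSym_comm]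

/-- Coefficients of the decomposition of `1` in central elements. -/
noncomputable def centralCoeff (μ : Diagrams N) : ℂ := exists_sum_centralSym_eq_one.choose μ

/-- The central idempotent of a diagram. -/
noncomputable def centralIdem (μ : Diagrams N) : MonoidAlgebra ℂ (Equiv.Perm (Fin N)) :=
  centralCoeff μ • centralSym μ

theorem sum_centralIdem [Fintype (Diagrams N)] : ∑ μ : Diagrams N, centralIdem μ = 1 := by
  rw [← finsum_eq_sum_of_fintype]
  exact exists_sum_centralSym_eq_one.choose_spec

theorem invMap_centralIdem (μ : Diagrams N) : invMap (centralIdem μ) = centralIdem μ := by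
  rw [centralIdem, invMap_smul, invMap_centralSym]

theorem centralIdem_mul_mul_diagSym_of_ne {μ ν : Diagrams N} (h : μ ≠ ν)
    (x : MonoidAlgebra ℂ (Equiv.Perm (Fin N))) : centralIdem μ * (x * diagSym ν) = 0 := by
  rw [← mul_assoc, centralIdem, smul_mul_assoc, smul_mul_assoc, centralSym_mul_mul_diagSym h,
    smul_zero]

theorem centralIdem_mul_mul_diagSym (μ : Diagrams N)
    (x : MonoidAlgebra ℂ (Equiv.Perm (Fin N))) :
    centralIdem μ * (x * diagSym μ) = x * diagSym μ := by
  classical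
  have := Fintype.ofFinite (Diagrams N)
  conv_rhs => rw [← one_mul (x * _), ← sum_centralIdem, Finset.sum_mul]
  rw [Finset.sum_eq_single μ]
  · intro ν _ h
    exact centralIdem_mul_mul_diagSym_of_ne h x
  · simp

end Completeness

/-! ### The group algebra acting on tensors -/

section Tensors

variable {k N : ℕ}

/-- The action of the group algebra on `V_N^{⊗k}`. -/
noncomputable def act (k : ℕ) {N : ℕ} :
    MonoidAlgebra ℂ (Equiv.Perm (Fin N)) →ₐ[ℂ] Module.End ℂ (TensorSpace k N) :=
  (tensorRep k N).asAlgebraHom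

theorem act_mul (x y : MonoidAlgebra ℂ (Equiv.Perm (Fin N))) (t : TensorSpace k N) :
    act k (x * y) t = act k x (act k y t) := by
  rw [map_mul, Module.End.mul_apply]

theorem act_smul (s : ℂ) (x : MonoidAlgebra ℂ (Equiv.Perm (Fin N))) (t : TensorSpace k N) :
    act k (s • x) t = s • act k x t := by
  rw [map_smul, LinearMap.smul_apply]

theorem act_single (g : Equiv.Perm (Fin N)) (s : ℂ) (t : TensorSpace k N) :
    act k (MonoidAlgebra.single g s) t = s • tensorRep k N g t := by
  rw [act, Representation.asAlgebraHom_single, LinearMap.smul_apply]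

theorem tensorRep_apply (g : Equiv.Perm (Fin N)) (t : TensorSpace k N) (i : Fin k → Fin N) :
    tensorRep k N g t i = t (g.symm ∘ i) := rfl

theorem act_apply (x : MonoidAlgebra ℂ (Equiv.Perm (Fin N))) (t : TensorSpace k N)
    (i : Fin k → Fin N) : act k x t i = ∑ g, x.coeff g * t (g.symm ∘ i) := by
  classical
  induction x using MonoidAlgebra.induction_linear with
  | zero => simp
  | add x y hx hy =>
    rw [map_add, LinearMap.add_apply, Pi.add_apply, hx, hy, ← Finset.sum_add_distrib]
    simp [add_mul]
  | single g s =>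
    rw [act_single, Pi.smul_apply, tensorRep_apply, Finset.sum_eq_single g]
    · simp
    · intro h _ hh
      simp [hh.symm]
    · simp

theorem tensorRep_dotProduct (g : Equiv.Perm (Fin N)) (t s : TensorSpace k N) :
    tensorRep k N g t ⬝ᵥ s = t ⬝ᵥ tensorRep k N g⁻¹ s := by
  refine Fintype.sum_equiv (Equiv.arrowCongr (Equiv.refl _) g.symm) _ _ fun i => ?_
  rw [tensorRep_apply, tensorRep_apply]
  congr 2
  funext a
  exact (g.apply_symm_apply _).symm

theorem act_dotProduct (x : MonoidAlgebra ℂ (Equiv.Perm (Fin N))) (t s : TensorSpace k N) :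
    act k x t ⬝ᵥ s = t ⬝ᵥ act k (invMap x) s := by
  induction x using MonoidAlgebra.induction_linear with
  | zero => simp [invMap_zero]
  | add x y hx hy =>
    rw [map_add, LinearMap.add_apply, add_dotProduct, hx, hy, invMap_add, map_add,
      LinearMap.add_apply, dotProduct_add]
  | single g r =>
    rw [invMap_single, act_single, act_single, smul_dotProduct, dotProduct_smul,
      tensorRep_dotProduct]

theorem star_act (x : MonoidAlgebra ℂ (Equiv.Perm (Fin N))) (t : TensorSpace k N) :
    star (act k x t) = act k (conjMap x) (star t) := by
  ext i
  rw [Pi.star_apply, act_apply, act_apply, star_sum]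
  refine Finset.sum_congr rfl fun g _ => ?_
  rw [coeff_conjMap, star_mul', Pi.star_apply]
  rfl

/-- Antisymmetrizing over columns kills tensors with few indices. -/
theorem act_altSum_eq_zero {c : Fin N → ℕ} {x y : Fin N} (hxy : x ≠ y) (hc : c x = c y)
    {t : TensorSpace k N} (ht : tensorRep k N (Equiv.swap x y) t = t) :
    act k (altSum c) t = 0 := by
  have h1 : act k (altSum c) t = -act k (altSum c) t := by
    conv_lhs => rw [← ht, ← one_smul ℂ (tensorRep k N (Equiv.swap x y) t), ← act_single, ← act_mul,
      altSum_mul_single (swap_mem_labelStab hc), Equiv.Perm.sign_swap hxy]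
    simp
  exact self_eq_neg.1 h1

/-- Pigeonhole: at least N - k entries avoid i, more than the `μ.rowLen 0` columns. -/
theorem exists_same_column_notMem_range {μ : YoungDiagram} (f : μ.cells ≃ Fin N) (i : Fin k → Fin N)
    (h : k < N - μ.rowLen 0) :
    ∃ x y, x ≠ y ∧ colOf f x = colOf f y ∧ x ∉ Set.range i ∧ y ∉ Set.range i := by
  classical
  have hcard : (Finset.range (μ.rowLen 0)).card < (Finset.univ \ Finset.univ.image i).card := by
    have h1 := Finset.le_card_sdiff (Finset.univ.image i) (Finset.univ : Finset (Fin N))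
    have h2 : (Finset.univ.image i).card ≤ k := by
      simpa using Finset.card_image_le (s := (Finset.univ : Finset (Fin k))) (f := i)
    rw [Finset.card_range]
    rw [Finset.card_univ, Fintype.card_fin] at h1
    omega
  obtain ⟨x, hx, y, hy, hxy, hc⟩ := Finset.exists_ne_map_eq_of_card_lt_of_maps_to hcard
    (f := colOf f) (fun x _ => by
      rw [Finset.mem_coe, Finset.mem_range, ← YoungDiagram.mem_iff_lt_rowLen]
      exact μ.up_left_mem (Nat.zero_le _) le_rfl (rowOf_colOf_mem f x))
  refine ⟨x, y, hxy, hc, ?_, ?_⟩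
  · simpa using hx
  · simpa using hy

theorem pi_single_eq {ι : Type*} [DecidableEq ι] (i j : ι) :
    (Pi.single i (1 : ℂ) : ι → ℂ) j = if j = i then 1 else 0 := Pi.single_apply _ _ _

/-- A basis tensor is fixed by the transposition of two entries that it does not contain. If these
share a column, antisymmetrization kills it. -/
theorem act_youngSym_eq_zero {μ : YoungDiagram} (f : μ.cells ≃ Fin N)
    (h : k < N - μ.rowLen 0) (t : TensorSpace k N) : act k (youngSym f) t = 0 := by
  classical
  have hz : act k (altSum (colOf f)) = 0 := by
    refine LinearMap.pi_ext' fun i => LinearMap.ext_ring ?_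
    obtain ⟨x, y, hxy, hc, hx, hy⟩ := exists_same_column_notMem_range f i h
    refine act_altSum_eq_zero hxy hc ?_
    ext j
    rw [tensorRep_apply, LinearMap.single_apply, pi_single_eq, pi_single_eq]
    congr 1
    have hi : Equiv.swap x y ∘ i = i := by
      funext a
      exact Equiv.swap_apply_of_ne_of_ne (fun h => hx ⟨a, h⟩) (fun h => hy ⟨a, h⟩)
    rw [Equiv.symm_swap, eq_iff_iff]
    constructor
    · intro h
      rw [← hi, ← h]
      funext a
      simp
    · rintro rfl
      exact hi
  rw [youngSym, act_mul, hz]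
  simp

theorem exists_range_superset (s : Finset (Fin N)) (hs : s.card ≤ k) (h : k ≠ 0 → N ≠ 0) :
    ∃ i : Fin k → Fin N, ∀ x ∈ s, x ∈ Set.range i := by
  classical
  rcases Nat.eq_zero_or_pos k with rfl | hk
  · refine ⟨Fin.elim0, fun x hx => ?_⟩
    rw [Finset.card_eq_zero.1 (Nat.le_zero.1 hs)] at hx
    simp at hx
  · have hN : 0 < N := Nat.pos_of_ne_zero (h hk.ne')
    refine ⟨fun a => if ha : a.1 < s.card then s.equivFin.symm ⟨a, ha⟩ else ⟨0, hN⟩, fun x hx => ?_⟩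
    refine ⟨⟨s.equivFin ⟨x, hx⟩, (s.equivFin ⟨x, hx⟩).2.trans_le hs⟩, ?_⟩
    simp

/-- The witness is a basis tensor e_i whose indices include every entry below the first row. If pq
fixes i, then q preserves rows and columns of these entries, so q = 1. No signs survive, and the
coefficient of e_i is a count that includes p = 1. -/
theorem exists_act_youngSym_ne_zero {μ : YoungDiagram} (f : μ.cells ≃ Fin N)
    (h : N - μ.rowLen 0 ≤ k) (hkN : k ≠ 0 → N ≠ 0) :
    ∃ t : TensorSpace k N, act k (youngSym f) t ≠ 0 := by
  classical
  have hcard : (Finset.univ.filter fun x => ¬ rowOf f x = 0).card ≤ k := by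
    have h1 := Finset.card_filter_add_card_filter_not (s := (Finset.univ : Finset (Fin N)))
      (fun x => rowOf f x = 0)
    rw [card_rowOf_eq, Finset.card_univ, Fintype.card_fin] at h1
    omega
  obtain ⟨i, hi⟩ := exists_range_superset _ hcard hkN
  refine ⟨Pi.single i 1, fun h0 => ?_⟩
  have h1 := congrFun h0 i
  have hq : ∀ p ∈ labelStab (rowOf f), ∀ q ∈ labelStab (colOf f), (p * q) ∘ i = i → q = 1 := by
    intro p hp q hq hpq
    have hfix : ∀ x, rowOf f x ≠ 0 → q x = x := by
      intro x hx
      obtain ⟨a, rfl⟩ := hi x (by simpa using hx)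
      refine eq_of_rowOf_colOf f ?_ (hq _)
      rw [← hp (q (i a))]
      exact congrArg (rowOf f) (congrFun hpq a)
    ext1 x
    -- A first-row entry either stays in its row and column, hence is fixed, or goes to an entry
    -- below that q fixes, which injectivity turns into q x = x.
    by_cases hx : rowOf f x = 0
    · by_cases hqx : rowOf f (q x) = 0
      · exact eq_of_rowOf_colOf f (hqx.trans hx.symm) (hq x)
      · exact q.injective (hfix _ hqx)
    · exact hfix x hx
  have h2 : act k (youngSym f) (Pi.single i 1) i
      = ((Finset.univ.filter fun p => p ∈ labelStab (rowOf f) ∧ p.symm ∘ i = i).card : ℂ) := by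
    rw [youngSym, act_mul, act_apply, Finset.card_filter, Nat.cast_sum]
    refine Finset.sum_congr rfl fun p _ => ?_
    rw [act_apply, coeff_symSum]
    by_cases hp : p ∈ labelStab (rowOf f)
    · rw [if_pos hp, one_mul, Finset.sum_eq_single 1]
      · simp [coeff_altSum, one_mem, hp, pi_single_eq]
        rfl
      · intro q _ hq1
        rw [coeff_altSum, pi_single_eq]
        split_ifs with h3 h4
        · refine absurd (hq p hp q h3 ?_) hq1
          conv_lhs => rw [← h4]
          funext a
          simp
        all_goals simp
      · simp
    · rw [if_neg hp, zero_mul, if_neg fun h => hp h.1, Nat.cast_zero]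
  rw [h2, Pi.zero_apply, Nat.cast_eq_zero, Finset.card_eq_zero, Finset.filter_eq_empty_iff] at h1
  exact h1 (Finset.mem_univ 1) ⟨one_mem _, rfl⟩

end Tensors

/-! ### Existence of Clebsch–Gordan bases -/

/-- A space of complex vectors closed under complex conjugation has a real orthonormal basis. -/
theorem exists_real_orthonormal_basis {W I : Type*} [AddCommGroup W] [Module ℂ W] [Fintype I]
    (L : W →ₗ[ℂ] (I → ℂ)) (hL : Function.Injective L) (hstar : ∀ w, ∃ w', L w' = star (L w)) :
    ∃ b : Module.Basis (Fin (Module.finrank ℂ W)) ℂ W,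
      (∀ a, star (L (b a)) = L (b a)) ∧
      ∀ a a', L (b a) ⬝ᵥ L (b a') = if a = a' then 1 else 0 := by
  classical
  let cx : EuclideanSpace ℝ I → I → ℂ := fun x i => (x i : ℂ)
  -- S is the real form of the image of L. A real orthonormal basis of it stays orthonormal for the
  -- complex bilinear dot product.
  let S : Submodule ℝ (EuclideanSpace ℝ I) :=
    { carrier := {x | ∃ w, L w = cx x}
      add_mem' := by
        rintro x y ⟨w, hw⟩ ⟨v, hv⟩
        refine ⟨w + v, ?_⟩
        rw [map_add, hw, hv]
        ext i
        simp [cx]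
      zero_mem' := ⟨0, by rw [map_zero]; ext i; simp [cx]⟩
      smul_mem' := by
        rintro r x ⟨w, hw⟩
        refine ⟨(r : ℂ) • w, ?_⟩
        rw [map_smul, hw]
        ext i
        simp [cx] }
  let e := stdOrthonormalBasis ℝ S
  choose v hv using fun j => (e j).2
  have hdot : ∀ a a', L (v a) ⬝ᵥ L (v a') = if a = a' then 1 else 0 := by
    intro a a'
    have h1 := orthonormal_iff_ite.1 e.orthonormal a a'
    rw [Submodule.coe_inner, PiLp.inner_apply] at h1
    rw [hv, hv]
    have h2 := congrArg (fun r : ℝ => (r : ℂ)) h1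
    simp only [Complex.ofReal_sum, apply_ite Complex.ofReal, Complex.ofReal_one,
      Complex.ofReal_zero] at h2
    rw [← h2]
    refine Finset.sum_congr rfl fun i _ => ?_
    rw [RCLike.inner_apply, conj_trivial, Complex.ofReal_mul, mul_comm]
  have hli : LinearIndependent ℂ v := by
    rw [linearIndependent_iff']
    intro s g h a ha
    have h1 := congrArg (fun w => L w ⬝ᵥ L (v a)) h
    simpa [map_sum, sum_dotProduct, hdot, ha] using h1
  have hreal : ∀ x ∈ S, cx x ∈ Submodule.span ℂ (Set.range fun j => L (v j)) := by
    intro x hx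
    have h1 := e.sum_repr ⟨x, hx⟩
    have h2 : cx x = ∑ j, ((e.repr ⟨x, hx⟩ j : ℝ) : ℂ) • L (v j) := by
      have h3 := congrArg (fun y : S => cx y.1) h1
      change _ = cx x at h3
      rw [← h3]
      ext i
      simp [cx, hv]
    rw [h2]
    exact Submodule.sum_mem _ fun j _ => Submodule.smul_mem _ _ (Submodule.subset_span ⟨j, rfl⟩)
  have hspan : ⊤ ≤ Submodule.span ℂ (Set.range v) := by
    intro w _
    obtain ⟨w', hw'⟩ := hstar w
    -- Closure under conjugation puts real and imaginary parts in S, so S spans over ℂ.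
    have hre : WithLp.toLp 2 (fun i => (L w i).re) ∈ S := by
      refine ⟨(1 / 2 : ℂ) • (w + w'), ?_⟩
      ext i
      simp [cx, hw', Complex.re_eq_add_conj]
      ring
    have him : WithLp.toLp 2 (fun i => (L w i).im) ∈ S := by
      refine ⟨(1 / (2 * Complex.I) : ℂ) • (w - w'), ?_⟩
      ext i
      simp [cx, hw', Complex.im_eq_sub_conj, Complex.inv_I, div_eq_mul_inv]
      ring
    have h1 : L w ∈ Submodule.span ℂ (Set.range fun j => L (v j)) := by
      have h2 : L w = cx (WithLp.toLp 2 (fun i => (L w i).re))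
          + Complex.I • cx (WithLp.toLp 2 (fun i => (L w i).im)) := by
        ext i
        simp [cx, mul_comm Complex.I]
      rw [h2]
      exact Submodule.add_mem _ (hreal _ hre) (Submodule.smul_mem _ _ (hreal _ him))
    have h2 : (Set.range fun j => L (v j)) = L '' Set.range v := (Set.range_comp L v)
    rw [h2, ← Submodule.map_span] at h1
    obtain ⟨u, hu, hu'⟩ := h1
    rwa [← hL hu']
  let b := Module.Basis.mk hli hspan
  have hcard : Module.finrank ℝ S = Module.finrank ℂ W := by
    rw [Module.finrank_eq_card_basis b, Fintype.card_fin]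
  have hb : ∀ a, b.reindex (finCongr hcard) a = v ((finCongr hcard).symm a) := by
    intro a
    simp [b]
  refine ⟨b.reindex (finCongr hcard), fun a => ?_, fun a a' => ?_⟩
  · rw [hb, hv]
    ext i
    simp [cx]
  · rw [hb, hb, hdot]
    simp

section Multiplicity

variable {k N : ℕ} (l : Lam k N)

/-- The diagram of an element of `Λ_{k,N}`. -/
def lamDiagram : Diagrams N := ⟨l.1, l.2.1⟩

theorem lamDiagram_injective : Function.Injective (lamDiagram : Lam k N → Diagrams N) :=
  fun _ _ h => Subtype.ext (congrArg (fun μ : Diagrams N => μ.1) h)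

/-- The generator of `V_λ`. -/
noncomputable def genV : V l := ⟨diagSym (lamDiagram l), Ideal.subset_span rfl⟩

theorem coe_genV : (genV l : MonoidAlgebra ℂ (Equiv.Perm (Fin N))) = diagSym (lamDiagram l) := rfl

theorem exists_eq_mul_diagSym (v : V l) : ∃ u, v.1 = u * diagSym (lamDiagram l) := by
  obtain ⟨u, hu⟩ := Ideal.mem_span_singleton'.1 v.2
  exact ⟨u, hu.symm⟩

theorem vRep_apply (g : Equiv.Perm (Fin N)) (v : V l) :
    vRep l g v = (MonoidAlgebra.single g (1 : ℂ)) • v := by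
  simp [vRep, Representation.ofModule']

variable {l}

theorem Z_smul (f : Z l) (x : MonoidAlgebra ℂ (Equiv.Perm (Fin N))) (v : V l) :
    f (x • v) = act k x (f v) := by
  induction x using MonoidAlgebra.induction_linear with
  | zero => simp
  | add x y hx hy => rw [add_smul, map_add, hx, hy, map_add, LinearMap.add_apply]
  | single g r =>
    have h1 : MonoidAlgebra.single g r • v = r • (MonoidAlgebra.single g (1 : ℂ) • v) := by
      rw [← smul_assoc]
      simp
    rw [h1, map_smul, ← vRep_apply, f.isIntertwining, act_single]

/-- Right multiplication by the symmetrizer is the scalar n on V_λ. Hence, for n ≠ 0, an intertwiner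
is determined by its value at the generator. -/
theorem Z_apply_mul (f : Z l) {n : ℂ}
    (hn : diagSym (lamDiagram l) * diagSym (lamDiagram l) = n • diagSym (lamDiagram l)) (v : V l) :
    act k v.1 (f (genV l)) = n • f v := by
  rw [← Z_smul, ← map_smul]
  congr 1
  obtain ⟨u, hu⟩ := exists_eq_mul_diagSym l v
  apply Subtype.ext
  change v.1 * diagSym (lamDiagram l) = n • v.1
  rw [hu, mul_assoc, hn, mul_smul_comm]

variable (l) in
/-- The equivariant map `v ↦ v t` from `V_λ` to `V_N^{⊗k}` given by a tensor `t`. -/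
noncomputable def ofTensor (t : TensorSpace k N) : Z l where
  toLinearMap :=
    { toFun := fun v => act k v.1 t
      map_add' := fun v w => by
        rw [Submodule.coe_add, map_add, LinearMap.add_apply]
      map_smul' := fun r v => by
        have : (r • v).1 = r • v.1 := rfl
        rw [this, act_smul, RingHom.id_apply] }
  isIntertwining' g := by
    refine LinearMap.ext fun v => ?_
    change act k (vRep l g v).1 t = tensorRep k N g (act k v.1 t)
    rw [vRep_apply, Submodule.coe_smul, smul_eq_mul, act_mul, act_single, one_smul]

theorem dimZ_pos (hN : 2 * k ≤ N) (l : Lam k N) : 0 < dimZ l := by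
  obtain ⟨t, ht⟩ := exists_act_youngSym_ne_zero (k := k) (diagFilling (lamDiagram l)) l.2.2
    (by omega)
  have : ofTensor l t ≠ 0 := by
    intro h
    apply ht
    have := congrArg (fun f : Z l => f (genV l)) h
    exact this
  have : Nontrivial (Z l) := ⟨⟨_, _, this⟩⟩
  exact Module.finrank_pos

/-- Scalar products of the images of two equivariant maps factorize. -/
theorem Z_dotProduct (f f' : Z l) (v w : V l) :
    (∑ g, (diagSym (lamDiagram l)).coeff g * (diagSym (lamDiagram l)).coeff g)
        * (f v ⬝ᵥ f' w)
      = (∑ g, v.1.coeff g * w.1.coeff g) * (f (genV l) ⬝ᵥ f' (genV l)) := by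
  obtain ⟨n, hn0, hn⟩ := youngSym_mul_self (diagFilling (lamDiagram l))
  have hn0' : (n : ℂ) ≠ 0 := Complex.ofReal_ne_zero.2 hn0
  -- The adjoint moves v to the other side, so only v^*w acts; by `invMap_mul_of_mem` it is, up to
  -- the scalar product of v and w, a fixed element.
  have key : ∀ v w : V l, (n : ℂ) * n * (f v ⬝ᵥ f' w)
      = f (genV l) ⬝ᵥ act k (invMap v.1 * w.1) (f' (genV l)) := by
    intro v w
    rw [act_mul, Z_apply_mul f' hn, ← invMap_invMap v.1, ← act_dotProduct, invMap_invMap,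
      Z_apply_mul f hn, smul_dotProduct, dotProduct_smul, smul_eq_mul, smul_eq_mul, mul_assoc]
  refine mul_left_cancel₀ (mul_ne_zero hn0' hn0') ?_
  obtain ⟨u, hu⟩ := exists_eq_mul_diagSym l v
  obtain ⟨u', hu'⟩ := exists_eq_mul_diagSym l w
  have h1 := invMap_mul_of_mem (diagFilling (lamDiagram l)) u u'
  change (∑ g, (diagSym (lamDiagram l)).coeff g * (diagSym (lamDiagram l)).coeff g)
        • (invMap (u * diagSym (lamDiagram l)) * (u' * diagSym (lamDiagram l)))
      = (∑ g, (u * diagSym (lamDiagram l)).coeff g * (u' * diagSym (lamDiagram l)).coeff g)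
        • (invMap (genV l).1 * (genV l).1) at h1
  rw [← hu, ← hu'] at h1
  rw [mul_left_comm, key, mul_left_comm _ (∑ g, v.1.coeff g * w.1.coeff g), key, ← smul_eq_mul,
    ← dotProduct_smul, ← act_smul, h1, act_smul, dotProduct_smul, smul_eq_mul]

theorem diagSym_norm (μ : Diagrams N) :
    ∃ s : ℝ, 0 < s ∧ ∑ g, (diagSym μ).coeff g * (diagSym μ).coeff g = (s : ℂ) := by
  refine ⟨∑ g, Complex.normSq ((diagSym μ).coeff g), ?_, ?_⟩
  · refine Finset.sum_pos' (fun g _ => Complex.normSq_nonneg _) ⟨1, Finset.mem_univ _, ?_⟩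
    rw [diagSym, coeff_youngSym_one]
    simp
  · rw [Complex.ofReal_sum]
    refine Finset.sum_congr rfl fun g _ => ?_
    rw [Complex.normSq_eq_conj_mul_self, ← coeff_conjMap, diagSym, conjMap_youngSym]

/-- By `Z_dotProduct` the scalar product of f v and f' w factors as (v·w)(f c·f' c)/s, where s is
the squared norm of the generator c. So V_λ gets a real orthonormal basis for its coefficients and
Z_λ one for values at c scaled by 1/√s. -/
theorem exists_bases (l : Lam k N) :
    ∃ (bV : Module.Basis (Fin (dimV l)) ℂ (V l)) (bZ : Module.Basis (Fin (dimZ l)) ℂ (Z l)),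
      (∀ a α, star (bZ α (bV a)) = bZ α (bV a)) ∧
      ∀ a b α β, bZ α (bV a) ⬝ᵥ bZ β (bV b) = if a = b ∧ α = β then 1 else 0 := by
  obtain ⟨n, hn0, hn⟩ := youngSym_mul_self (diagFilling (lamDiagram l))
  have hn0' : (n : ℂ) ≠ 0 := Complex.ofReal_ne_zero.2 hn0
  obtain ⟨s, hs0, hs⟩ := diagSym_norm (lamDiagram l)
  have hsq : (((Real.sqrt s)⁻¹ : ℝ) : ℂ) * (((Real.sqrt s)⁻¹ : ℝ) : ℂ) * s = 1 := by
    rw [← Complex.ofReal_mul, ← Complex.ofReal_mul, ← mul_inv, Real.mul_self_sqrt hs0.le,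
      inv_mul_cancel₀ hs0.ne', Complex.ofReal_one]
  have hq : (((Real.sqrt s)⁻¹ : ℝ) : ℂ) ≠ 0 := by
    intro h
    rw [h] at hsq
    simp at hsq
  let LV : V l →ₗ[ℂ] (Equiv.Perm (Fin N) → ℂ) :=
    { toFun := fun v g => v.1.coeff g
      map_add' := fun v w => by ext g; simp
      map_smul' := fun r v => rfl }
  let LZ : Z l →ₗ[ℂ] ((Fin k → Fin N) → ℂ) :=
    { toFun := fun f => (((Real.sqrt s)⁻¹ : ℝ) : ℂ) • f (genV l)
      map_add' := fun f f' => smul_add _ _ _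
      map_smul' := fun r f => smul_comm (((Real.sqrt s)⁻¹ : ℝ) : ℂ) r (f (genV l)) }
  obtain ⟨bV, hV1, hV2⟩ := exists_real_orthonormal_basis LV
    (fun v w h => Subtype.ext (MonoidAlgebra.ext (Finsupp.ext fun g => congrFun h g)))
    (fun v => by
      obtain ⟨u, hu⟩ := exists_eq_mul_diagSym l v
      refine ⟨conjMap u • genV l, ?_⟩
      ext g
      change (conjMap u * diagSym (lamDiagram l)).coeff g = star (v.1.coeff g)
      have : conjMap u * diagSym (lamDiagram l) = conjMap v.1 := by
        rw [hu, map_mul]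
        congr 1
        exact (conjMap_youngSym _).symm
      rw [this, coeff_conjMap]
      rfl)
  obtain ⟨bZ, hZ1, hZ2⟩ := exists_real_orthonormal_basis LZ
    (fun f f' h => by
      have h1 : f (genV l) = f' (genV l) := smul_right_injective _ hq h
      refine DFunLike.ext _ _ fun v => ?_
      refine smul_right_injective _ hn0' ?_
      change (n : ℂ) • f v = (n : ℂ) • f' v
      rw [← Z_apply_mul f hn, ← Z_apply_mul f' hn, h1])
    (fun f => by
      -- The conjugate intertwiner: c is real, so c acts on the conjugate of f(c) as the real scalar
      -- n, which the factor n⁻¹ cancels.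
      refine ⟨(n : ℂ)⁻¹ • ofTensor l (star (f (genV l))), ?_⟩
      rw [map_smul]
      change (n : ℂ)⁻¹ • (((Real.sqrt s)⁻¹ : ℝ) : ℂ) • act k (genV l).1 (star (f (genV l)))
        = star ((((Real.sqrt s)⁻¹ : ℝ) : ℂ) • f (genV l))
      have h1 : act k (genV l).1 (star (f (genV l))) = (n : ℂ) • star (f (genV l)) := by
        have h2 := star_act (genV l).1 (f (genV l))
        rw [Z_apply_mul f hn, star_smul, coe_genV, diagSym, conjMap_youngSym] at h2
        rw [coe_genV, diagSym, ← h2]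
        simp
      rw [h1, smul_comm, inv_smul_smul₀ hn0', star_smul]
      simp)
  refine ⟨bV, bZ, fun a α => ?_, fun a b α β => ?_⟩
  · refine smul_right_injective _ hn0' ?_
    change (n : ℂ) • star (bZ α (bV a)) = (n : ℂ) • bZ α (bV a)
    have h1 : star (bZ α (genV l)) = bZ α (genV l) := by
      have h2 := hZ1 α
      change star ((((Real.sqrt s)⁻¹ : ℝ) : ℂ) • bZ α (genV l))
        = (((Real.sqrt s)⁻¹ : ℝ) : ℂ) • bZ α (genV l) at h2
      rw [star_smul, Complex.star_def, Complex.conj_ofReal] at h2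
      exact smul_right_injective _ hq h2
    have h2 : conjMap (bV a).1 = (bV a).1 := by
      ext g
      rw [coeff_conjMap]
      exact congrFun (hV1 a) g
    have h3 := star_act (bV a).1 (bZ α (genV l))
    rw [h1, h2, Z_apply_mul _ hn, star_smul, Complex.star_def, Complex.conj_ofReal] at h3
    exact h3
  · have h1 := Z_dotProduct (bZ α) (bZ β) (bV a) (bV b)
    have h2 : ∑ g, (bV a).1.coeff g * (bV b).1.coeff g = if a = b then 1 else 0 := hV2 a b
    have h3 : (((Real.sqrt s)⁻¹ : ℝ) : ℂ) • bZ α (genV l)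
        ⬝ᵥ (((Real.sqrt s)⁻¹ : ℝ) : ℂ) • bZ β (genV l) = if α = β then 1 else 0 := hZ2 α β
    rw [smul_dotProduct, dotProduct_smul, smul_eq_mul, smul_eq_mul, ← mul_assoc] at h3
    rw [hs, h2] at h1
    have h4 : bZ α (bV a) ⬝ᵥ bZ β (bV b)
        = (((Real.sqrt s)⁻¹ : ℝ) : ℂ) * (((Real.sqrt s)⁻¹ : ℝ) : ℂ)
          * ((s : ℂ) * (bZ α (bV a) ⬝ᵥ bZ β (bV b))) := by
      rw [← mul_assoc, hsq, one_mul]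
    rw [h1, mul_left_comm, h3] at h4
    refine h4.trans ?_
    by_cases hab : a = b <;> by_cases hαβ : α = β <;> simp [hab, hαβ]

theorem nonempty_clebschGordan (k N : ℕ) : Nonempty (ClebschGordan k N) := by
  choose bV bZ h1 h2 using fun l : Lam k N => exists_bases l
  refine ⟨⟨bV, bZ, fun l a α i => congrFun (h1 l a α) i, fun l a b α β => ?_⟩⟩
  rw [← h2 l a b α β]
  refine Finset.sum_congr rfl fun i _ => ?_
  congr 1
  exact congrFun (h1 l a α) i

end Multiplicity

/-! ### The image of the partition algebra and the trace form -/

section Image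

variable {k N : ℕ}

theorem diagMatrix_eq_ite (π : SetPart k) (o : Fin k ⊕ Fin k → Fin N)
    [Decidable (π ≤ Setoid.ker o)] :
    diagMatrix ℂ N π (fun a => o (Sum.inr a)) (fun a => o (Sum.inl a))
      = if π ≤ Setoid.ker o then 1 else 0 := by
  have h : Sum.elim (fun a => o (Sum.inl a)) (fun a => o (Sum.inr a)) = o := by
    ext (a | a) <;> rfl
  rw [diagMatrix, h]
  congr 1

/-- A partition of 2k points has at most 2k ≤ N blocks, which can receive distinct labels. -/
theorem exists_ker_eq (hN : 2 * k ≤ N) (π : SetPart k) :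
    ∃ o : Fin k ⊕ Fin k → Fin N, Setoid.ker o = π := by
  have hc : Nat.card (Quotient π) ≤ Nat.card (Fin N) := by
    refine le_trans (Nat.card_le_card_of_surjective (Quotient.mk π) Quotient.mk_surjective) ?_
    simp
    omega
  classical
  obtain ⟨f⟩ := Function.Embedding.nonempty_of_card_le
    (α := Quotient π) (β := Fin N) (by simpa [Nat.card_eq_fintype_card] using hc)
  refine ⟨fun x => f (Quotient.mk π x), ?_⟩
  ext x y
  rw [Setoid.ker_def, f.injective.eq_iff, Quotient.eq]

/-- Equal coincidences give a bijection between the sets of values, and it extends to a permutation.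
So S_N-orbits of tuples are classified by their kernels. -/
theorem exists_perm_of_ker_eq {X : Type*} {o o' : X → Fin N}
    (h : Setoid.ker o = Setoid.ker o') : ∃ σ : Equiv.Perm (Fin N), σ ∘ o = o' := by
  classical
  have hk : ∀ x y, o x = o y ↔ o' x = o' y := fun x y => by
    rw [← Setoid.ker_def (f := o), ← Setoid.ker_def (f := o'), h]
  let e : {i // i ∈ Set.range o} ≃ {i // i ∈ Set.range o'} :=
    Equiv.ofBijective (fun i => ⟨o' i.2.choose, ⟨_, rfl⟩⟩) (by
      constructor
      · intro i j hij
        have := (hk _ _).2 (Subtype.ext_iff.1 hij)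
        rw [i.2.choose_spec, j.2.choose_spec] at this
        exact Subtype.ext this
      · rintro ⟨_, x, rfl⟩
        refine ⟨⟨o x, x, rfl⟩, Subtype.ext ?_⟩
        rw [← hk]
        exact Exists.choose_spec (⟨x, rfl⟩ : o x ∈ Set.range o))
  refine ⟨e.extendSubtype, ?_⟩
  funext x
  rw [Function.comp_apply, Equiv.extendSubtype_apply_of_mem _ _ ⟨x, rfl⟩]
  change o' _ = o' x
  rw [← hk]
  exact Exists.choose_spec (⟨x, rfl⟩ : o x ∈ Set.range o)

instance : Finite (SetPart k) :=
  Finite.of_injective (fun (π : SetPart k) a b => π a b) fun _ _ h =>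
    Setoid.ext fun a b => iff_of_eq (congrFun (congrFun h a) b)

/-- The entry at a tuple with kernel ρ is the sum of the coefficients of d over π ≤ ρ. This
triangular system forces all coefficients to vanish, by induction from finer to coarser ρ. -/
theorem toMat_injective (hN : 2 * k ≤ N) : Function.Injective (toMat k N) := by
  classical
  have := Fintype.ofFinite (SetPart k)
  rw [injective_iff_map_eq_zero]
  intro d hd
  have hsum : ∀ ρ : SetPart k, ∑ π, (if π ≤ ρ then (diagBasis k N).repr d π else 0) = 0 := by
    intro ρ
    obtain ⟨o, rfl⟩ := exists_ker_eq hN ρ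
    rw [← (diagBasis k N).sum_repr d, map_sum] at hd
    have h1 := congrFun (congrFun hd fun a => o (Sum.inr a)) fun a => o (Sum.inl a)
    rw [Matrix.sum_apply] at h1
    refine Eq.trans ?_ h1
    refine Finset.sum_congr rfl fun π _ => ?_
    rw [map_smul, toMat_diagBasis, Matrix.smul_apply, diagMatrix_eq_ite]
    simp
  have hz : ∀ ρ : SetPart k, (diagBasis k N).repr d ρ = 0 := by
    intro ρ
    induction ρ using WellFoundedLT.induction with
    | ind ρ ih =>
      rw [← hsum ρ, Finset.sum_eq_single ρ]
      · simp
      · intro π _ hπ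
        split_ifs with h
        · exact ih π (lt_of_le_of_ne h hπ)
        · rfl
      · simp
  exact (diagBasis k N).repr.map_eq_zero_iff.1 (Finsupp.ext hz)

/-! ### The image is the full commutant. -/

/-- The matrices that commute with the action of the symmetric group. -/
def IsInvariant (M : Matrix (Fin k → Fin N) (Fin k → Fin N) ℂ) : Prop :=
  ∀ (σ : Equiv.Perm (Fin N)) (i' i : Fin k → Fin N), M (σ ∘ i') (σ ∘ i) = M i' i

open Classical in
/-- The indicator of the index tuples whose coincidences are exactly those of `π`. -/
noncomputable def orbitMatrix (N : ℕ) (π : SetPart k) :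
    Matrix (Fin k → Fin N) (Fin k → Fin N) ℂ :=
  fun i' i => if Setoid.ker (Sum.elim i i') = π then 1 else 0

theorem orbitMatrix_mem_range (π : SetPart k) :
    orbitMatrix N π ∈ LinearMap.range (toMat k N).toLinearMap := by
  classical
  have := Fintype.ofFinite (SetPart k)
  induction π using WellFoundedGT.induction with
  | ind π ih =>
    -- Inversion of D_π = ∑_{ρ ≥ π} (orbit indicator of ρ), by induction from the coarsest
    -- partition.
    have h : orbitMatrix N π = diagMatrix ℂ N π
        - ∑ ρ ∈ Finset.univ.filter (π < ·), orbitMatrix N ρ := by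
      ext i' i
      have h1 := diagMatrix_eq_ite π (Sum.elim i i')
      simp only [Sum.elim_inl, Sum.elim_inr] at h1
      change diagMatrix ℂ N π i' i = _ at h1
      rw [Matrix.sub_apply, Matrix.sum_apply, h1, Finset.sum_filter]
      simp only [orbitMatrix]
      rw [Finset.sum_eq_single (Setoid.ker (Sum.elim i i'))]
      · rw [if_pos rfl]
        by_cases h2 : Setoid.ker (Sum.elim i i') = π
        · simp [h2]
        · by_cases h3 : π ≤ Setoid.ker (Sum.elim i i')
          · simp [h2, h3, lt_of_le_of_ne h3 (Ne.symm h2)]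
          · have h4 : ¬π < Setoid.ker (Sum.elim i i') := fun h => h3 h.le
            simp [h2, h3, h4]
      · intro ρ _ hρ
        rw [if_neg (Ne.symm hρ)]
        simp
      · simp
    rw [h]
    refine Submodule.sub_mem _ ⟨diagBasis k N π, toMat_diagBasis π⟩
      (Submodule.sum_mem _ fun ρ hρ => ih ρ (Finset.mem_filter.1 hρ).2)

theorem exists_toMat_eq (hN : 2 * k ≤ N) {M : Matrix (Fin k → Fin N) (Fin k → Fin N) ℂ}
    (hM : IsInvariant M) : ∃ d, toMat k N d = M := by
  classical
  have := Fintype.ofFinite (SetPart k)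
  choose o ho using exists_ker_eq hN (k := k)
  have h : M = ∑ π, M (fun a => o π (Sum.inr a)) (fun a => o π (Sum.inl a)) • orbitMatrix N π := by
    ext i' i
    rw [Matrix.sum_apply, Finset.sum_eq_single (Setoid.ker (Sum.elim i i'))]
    · obtain ⟨σ, hσ⟩ := exists_perm_of_ker_eq (ho (Setoid.ker (Sum.elim i i')))
      rw [Matrix.smul_apply, orbitMatrix, if_pos rfl, smul_eq_mul, mul_one,
        ← hM σ (fun a => o _ (Sum.inr a))]
      have h1 : ∀ x, σ (o (Setoid.ker (Sum.elim i i')) x) = Sum.elim i i' x := congrFun hσ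
      congr 1
      · funext a
        exact (h1 (Sum.inr a)).symm
      · funext a
        exact (h1 (Sum.inl a)).symm
    · intro π _ hπ
      rw [Matrix.smul_apply, orbitMatrix, if_neg (Ne.symm hπ), smul_zero]
    · simp
  have h2 : M ∈ LinearMap.range (toMat k N).toLinearMap := by
    rw [h]
    exact Submodule.sum_mem _ fun π _ => Submodule.smul_mem _ _ (orbitMatrix_mem_range π)
  exact h2

/-! ### The trace form, its Gram matrix and dual bases. -/

theorem traceForm_apply (d d' : PartitionAlgebra k N) :
    traceForm k N d d' = ∑ i', ∑ i, toMat k N d i' i * toMat k N d' i' i := rfl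

theorem traceForm_comm (d d' : PartitionAlgebra k N) :
    traceForm k N d d' = traceForm k N d' d := by
  rw [traceForm_apply, traceForm_apply]
  simp only [mul_comm]

/-- The complex conjugate of D is again invariant, hence the image of some d', and pairing d with d'
gives the sum of the squared moduli of the entries of D. -/
theorem traceForm_nondegenerate (hN : 2 * k ≤ N) : (traceForm k N).Nondegenerate := by
  have hsep : ∀ d, (∀ d', traceForm k N d d' = 0) → d = 0 := by
    intro d hd
    obtain ⟨d', hd'⟩ := exists_toMat_eq hN
      (M := fun i' i => (starRingEnd ℂ) (toMat k N d i' i)) (fun σ i' i =>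
        congrArg (starRingEnd ℂ) (toMat_perm d σ i' i))
    have h1 := hd d'
    rw [traceForm_apply, hd'] at h1
    simp only [Complex.mul_conj, ← Complex.ofReal_sum, Complex.ofReal_eq_zero] at h1
    refine toMat_injective hN ?_
    rw [map_zero]
    ext i' i
    have h2 := (Finset.sum_eq_zero_iff_of_nonneg fun _ _ =>
      Finset.sum_nonneg fun _ _ => Complex.normSq_nonneg _).1 h1 i' (Finset.mem_univ _)
    rw [Finset.sum_eq_zero_iff_of_nonneg fun _ _ => Complex.normSq_nonneg _] at h2
    exact Complex.normSq_eq_zero.1 (h2 i (Finset.mem_univ _))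
  exact ⟨hsep, fun d hd => hsep d fun d' => (traceForm_comm d d').trans (hd d')⟩

theorem toMat_transpose (d : PartitionAlgebra k N) :
    toMat k N (transpose k N d) = (toMat k N d).transpose := by
  classical
  induction d using induct with
  | h0 => simp
  | ha x y hx hy => simp [hx, hy]
  | hs c x hx => simp [hx]
  | hb π =>
    rw [transpose, Module.Basis.constr_basis, toMat_diagBasis, toMat_diagBasis]
    ext i' i
    rw [Matrix.transpose_apply, diagMatrix, diagMatrix]
    congr 1
    rw [eq_iff_iff]
    have hsw : ∀ a : Fin k ⊕ Fin k, Sum.elim i i' a.swap = Sum.elim i' i a := by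
      rintro (a | a) <;> rfl
    constructor
    · intro h a b hab
      rw [← hsw a, ← hsw b]
      refine h _ _ ?_
      change π a.swap.swap b.swap.swap
      rwa [Sum.swap_swap, Sum.swap_swap]
    · intro h a b hab
      have := h _ _ hab
      rwa [← hsw, ← hsw, Sum.swap_swap, Sum.swap_swap] at this

theorem gram_apply {ι : Type*} (b : Module.Basis ι ℂ (PartitionAlgebra k N)) (i j : ι) :
    gram b i j = traceForm k N (b i) (transpose k N (b j)) := by
  change _ = Matrix.trace (toMat k N (b i) * (toMat k N (transpose k N (b j))).transpose)
  rw [toMat_transpose, Matrix.transpose_transpose]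
  rfl

variable {ι : Type*} [Fintype ι] [DecidableEq ι] (b : Module.Basis ι ℂ (PartitionAlgebra k N))

theorem transpose_transpose (d : PartitionAlgebra k N) :
    transpose k N (transpose k N d) = d := by
  induction d using induct with
  | h0 => simp
  | ha x y hx hy => simp [hx, hy]
  | hs c x hx => simp [hx]
  | hb π =>
    rw [transpose, Module.Basis.constr_basis, Module.Basis.constr_basis]
    congr 1
    ext a b
    change π a.swap.swap b.swap.swap ↔ _
    rw [Sum.swap_swap, Sum.swap_swap]

theorem isUnit_det_gram (hN : 2 * k ≤ N) : IsUnit (gram b).det := by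
  rw [isUnit_iff_ne_zero]
  intro h
  obtain ⟨v, hv, hv0⟩ := Matrix.exists_mulVec_eq_zero_iff.2 h
  apply hv
  -- Since g_{ij} = ⟨b_i, b_j^T⟩, a null vector of the Gram matrix yields a transpose orthogonal to
  -- everything.
  have h1 : transpose k N (∑ j, v j • b j) = 0 := by
    refine (traceForm_nondegenerate hN).2 _ fun d => ?_
    rw [← b.sum_repr d, map_sum, LinearMap.sum_apply]
    refine Finset.sum_eq_zero fun i _ => ?_
    rw [map_smul, LinearMap.smul_apply, map_sum, map_sum]
    have h2 := congrFun hv0 i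
    have h3 : ∑ j, traceForm k N (b i) (transpose k N (v j • b j)) = 0 := by
      refine Eq.trans ?_ h2
      refine Finset.sum_congr rfl fun j _ => ?_
      rw [map_smul, map_smul, ← gram_apply, smul_eq_mul, mul_comm]
    rw [h3, smul_zero]
  have h2 := congrArg (transpose k N) h1
  rw [transpose_transpose, map_zero] at h2
  funext j
  exact Fintype.linearIndependent_iff.1 b.linearIndependent v h2 j

theorem traceForm_dual (hN : 2 * k ≤ N) (i j : ι) :
    traceForm k N (b i) (dual b j) = if i = j then 1 else 0 := by
  rw [← Matrix.one_apply, ← Matrix.mul_nonsing_inv _ (isUnit_det_gram b hN), Matrix.mul_apply,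
    dual, map_sum]
  refine Finset.sum_congr rfl fun m _ => ?_
  rw [map_smul, ← gram_apply, smul_eq_mul, mul_comm]

/-- The element of `P_k(N)` that represents a linear functional in terms of dual bases. -/
theorem sum_dual_smul_eq (hN : 2 * k ≤ N) (φ : PartitionAlgebra k N →ₗ[ℂ] ℂ)
    (e : PartitionAlgebra k N) (he : ∀ d, traceForm k N e d = φ d) :
    ∑ i, φ (dual b i) • b i = e := by
  have h : ∀ i, b.repr e i = φ (dual b i) := by
    intro i
    rw [← he]
    conv_rhs => rw [← b.sum_repr e]
    rw [map_sum, LinearMap.sum_apply, Finset.sum_eq_single i]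
    · rw [map_smul, LinearMap.smul_apply, traceForm_dual b hN, if_pos rfl, smul_eq_mul, mul_one]
    · intro j _ hj
      rw [map_smul, LinearMap.smul_apply, traceForm_dual b hN, if_neg hj, smul_zero]
    · simp
  rw [← b.sum_repr e]
  simp only [h]

end Image

/-! ### Matrix units -/

section MatrixUnits

variable {k N : ℕ}

instance : Finite (Lam k N) := Finite.of_injective _ lamDiagram_injective

theorem zRep_apply (l : Lam k N) (d : PartitionAlgebra k N) (f : Z l) (v : V l) :
    zRep l d f v = (toMat k N d).mulVec (f v) := rfl

/-- The images of inequivalent irreducible representations are orthogonal. -/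
theorem Z_dotProduct_of_ne {l l' : Lam k N} (h : l ≠ l') (f : Z l) (f' : Z l') (v : V l)
    (w : V l') : f v ⬝ᵥ f' w = 0 := by
  -- The central idempotent of l is 1 on V_l, 0 on V_{l'} and self-adjoint for the dot product.
  have h1 : centralIdem (lamDiagram l) • v = v := by
    obtain ⟨u, hu⟩ := exists_eq_mul_diagSym l v
    apply Subtype.ext
    rw [Submodule.coe_smul, hu, smul_eq_mul, centralIdem_mul_mul_diagSym]
  have h2 : centralIdem (lamDiagram l) • w = 0 := by
    obtain ⟨u, hu⟩ := exists_eq_mul_diagSym l' w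
    apply Subtype.ext
    rw [Submodule.coe_smul, hu, smul_eq_mul,
      centralIdem_mul_mul_diagSym_of_ne fun h' => h (lamDiagram_injective h')]
    rfl
  rw [← h1, Z_smul, act_dotProduct, invMap_centralIdem, ← Z_smul, h2, map_zero, dotProduct_zero]

theorem act_centralIdem_eq (μ : Diagrams N) (t : TensorSpace k N) :
    act k (centralIdem μ) t = centralCoeff μ • ∑ g : Equiv.Perm (Fin N),
      act k (MonoidAlgebra.single g 1) (act k (diagSym μ)
        (act k (MonoidAlgebra.single g⁻¹ 1) t)) := by
  rw [centralIdem, act_smul, centralSym, classSum, map_sum, LinearMap.sum_apply]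
  simp only [act_mul]

/-- The decomposition of 1 writes every tensor as a combination of terms g c_μ t'. Such a term is a
value of the intertwiner `ofTensor` if μ ∈ Λ_{k,N}, where d acts by 0, and is itself 0 otherwise. -/
theorem eq_zero_of_zRep_eq_zero (hN : 2 * k ≤ N) {d : PartitionAlgebra k N}
    (h : ∀ l : Lam k N, zRep l d = 0) : d = 0 := by
  have := Fintype.ofFinite (Diagrams N)
  refine toMat_injective hN ?_
  rw [map_zero]
  refine Matrix.ext_of_mulVec_single fun i => ?_
  rw [Matrix.zero_mulVec]
  generalize (Pi.single i 1 : TensorSpace k N) = t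
  have h1 : t = ∑ μ : Diagrams N, act k (centralIdem μ) t := by
    rw [← LinearMap.sum_apply, ← map_sum, sum_centralIdem, map_one, Module.End.one_apply]
  rw [h1, ← Matrix.mulVecLin_apply, map_sum]
  refine Finset.sum_eq_zero fun μ _ => ?_
  rw [act_centralIdem_eq, map_smul, map_sum, Finset.sum_eq_zero, smul_zero]
  intro g _
  generalize act k (MonoidAlgebra.single g⁻¹ 1) t = t'
  by_cases hμ : N - μ.1.rowLen 0 ≤ k
  · let l : Lam k N := ⟨μ.1, μ.2, hμ⟩
    have h2 := congrArg (fun F : Module.End ℂ (Z l) =>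
      F (ofTensor l t') (MonoidAlgebra.single g (1 : ℂ) • genV l)) (h l)
    rw [← act_mul]
    exact h2
  · rw [diagSym, act_youngSym_eq_zero _ (not_le.1 hμ), map_zero, map_zero]

variable (C : ClebschGordan k N)

namespace ClebschGordan

theorem dotProduct_eq (l : Lam k N) (a b : Fin (dimV l)) (α β : Fin (dimZ l)) :
    C.basisZ l α (C.basisV l a) ⬝ᵥ C.basisZ l β (C.basisV l b)
      = if a = b ∧ α = β then 1 else 0 := by
  rw [← C.orthonormal l a b α β]
  refine Finset.sum_congr rfl fun i _ => ?_
  rw [C.real]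

theorem zRep_basisZ (l : Lam k N) (d : PartitionAlgebra k N) (β : Fin (dimZ l)) :
    zRep l d (C.basisZ l β) = ∑ α, C.D l d α β • C.basisZ l α := by
  conv_lhs => rw [← (C.basisZ l).sum_repr (zRep l d (C.basisZ l β))]
  refine Finset.sum_congr rfl fun α _ => ?_
  rw [D, LinearMap.toMatrix_apply]

/-- The operator `∑_a C^λ_{a,α} (C^λ_{a,β})^T` on tensors. -/
noncomputable def unitMatrix (l : Lam k N) (α β : Fin (dimZ l)) :
    Matrix (Fin k → Fin N) (Fin k → Fin N) ℂ :=
  fun i' i => ∑ a, C.basisZ l α (C.basisV l a) i' * C.basisZ l β (C.basisV l a) i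

theorem isInvariant_unitMatrix (l : Lam k N) (α β : Fin (dimZ l)) :
    IsInvariant (C.unitMatrix l α β) := by
  classical
  intro σ i' i
  let ρ : Matrix (Fin (dimV l)) (Fin (dimV l)) ℂ :=
    LinearMap.toMatrix (C.basisV l) (C.basisV l) (vRep l σ⁻¹)
  have h1 : ∀ a, vRep l σ⁻¹ (C.basisV l a) = ∑ b, ρ b a • C.basisV l b := by
    intro a
    conv_lhs => rw [← (C.basisV l).sum_repr (vRep l σ⁻¹ (C.basisV l a))]
    refine Finset.sum_congr rfl fun b _ => ?_
    congr 1
    exact (LinearMap.toMatrix_apply _ _ _ _ _).symm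
  have h2 : ∀ γ a, tensorRep k N σ⁻¹ (C.basisZ l γ (C.basisV l a))
      = ∑ b, ρ b a • C.basisZ l γ (C.basisV l b) := by
    intro γ a
    rw [← (C.basisZ l γ).isIntertwining, h1, map_sum]
    simp only [map_smul]
  have h3 : ∀ γ a j, C.basisZ l γ (C.basisV l a) (σ ∘ j)
      = ∑ b, ρ b a * C.basisZ l γ (C.basisV l b) j := by
    intro γ a j
    have := congrFun (h2 γ a) j
    rw [Finset.sum_apply] at this
    exact this
  -- Permutations preserve the dot product and the Clebsch–Gordan vectors of one fixed α are
  -- orthonormal, so ρ is orthogonal. This makes the sum over a invariant.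
  have h4 : ρ.transpose * ρ = 1 := by
    ext a b
    have h5 := tensorRep_dotProduct σ⁻¹ (C.basisZ l α (C.basisV l a))
      (tensorRep k N σ⁻¹ (C.basisZ l α (C.basisV l b)))
    rw [← Module.End.mul_apply, ← map_mul, inv_mul_cancel, map_one, Module.End.one_apply,
      dotProduct_eq, h2, h2] at h5
    simp only [sum_dotProduct, dotProduct_sum, smul_dotProduct, dotProduct_smul, dotProduct_eq,
      smul_eq_mul] at h5
    rw [Matrix.mul_apply, Matrix.one_apply]
    simpa [mul_comm] using h5
  have h5 : ρ * ρ.transpose = 1 := mul_eq_one_comm.1 h4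
  have h6 : ∀ b b', ∑ a, ρ b a * ρ b' a = if b = b' then 1 else 0 := by
    intro b b'
    rw [← Matrix.one_apply, ← h5, Matrix.mul_apply]
    rfl
  simp only [unitMatrix, h3, Finset.sum_mul_sum]
  rw [Finset.sum_comm]
  refine Finset.sum_congr rfl fun b _ => ?_
  rw [Finset.sum_comm, Finset.sum_eq_single b]
  · have : ∀ a, ρ b a * C.basisZ l α (C.basisV l b) i' * (ρ b a * C.basisZ l β (C.basisV l b) i)
        = ρ b a * ρ b a * (C.basisZ l α (C.basisV l b) i' * C.basisZ l β (C.basisV l b) i) :=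
      fun a => by ring
    simp only [this]
    rw [← Finset.sum_mul, h6, if_pos rfl, one_mul]
  · intro b' _ hb
    have : ∀ a, ρ b a * C.basisZ l α (C.basisV l b) i' * (ρ b' a * C.basisZ l β (C.basisV l b') i)
        = ρ b a * ρ b' a * (C.basisZ l α (C.basisV l b) i' * C.basisZ l β (C.basisV l b') i) :=
      fun a => by ring
    simp only [this]
    rw [← Finset.sum_mul, h6, if_neg (Ne.symm hb), zero_mul]
  · simp

theorem unitMatrix_mulVec (l : Lam k N) (α β : Fin (dimZ l)) (t : TensorSpace k N) :
    (C.unitMatrix l α β).mulVec t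
      = ∑ a, (C.basisZ l β (C.basisV l a) ⬝ᵥ t) • C.basisZ l α (C.basisV l a) := by
  ext i'
  rw [Finset.sum_apply]
  simp only [Matrix.mulVec, dotProduct, unitMatrix, Pi.smul_apply, smul_eq_mul, Finset.sum_mul]
  rw [Finset.sum_comm]
  refine Finset.sum_congr rfl fun a _ => Finset.sum_congr rfl fun i _ => ?_
  ring

variable {ι : Type*} [Fintype ι] [DecidableEq ι] (b : Module.Basis ι ℂ (PartitionAlgebra k N))

/-- The invariant matrix on the right comes from some e. Its trace pairing with d is ∑_a C_{a,α}·(d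
C_{a,β}), each summand being D^λ_{αβ}(d); the factor dim V_λ in Q is the number of summands, and
`sum_dual_smul_eq` identifies e with Q. -/
theorem toMat_Q (hN : 2 * k ≤ N) (l : Lam k N) (α β : Fin (dimZ l)) :
    toMat k N (C.Q b l α β) = C.unitMatrix l α β := by
  obtain ⟨e, he⟩ := exists_toMat_eq hN (C.isInvariant_unitMatrix l α β)
  let φ : PartitionAlgebra k N →ₗ[ℂ] ℂ :=
    { toFun := fun d => (dimV l : ℂ) * C.D l d α β
      map_add' := fun d d' => by simp [D, mul_add]
      map_smul' := fun r d => by simp [D, mul_left_comm] }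
  have h1 : ∀ d, traceForm k N e d = φ d := by
    intro d
    have h2 : ∀ a, C.basisZ l α (C.basisV l a) ⬝ᵥ zRep l d (C.basisZ l β) (C.basisV l a)
        = C.D l d α β := by
      intro a
      rw [zRep_basisZ, Representation.IntertwiningMap.sum_apply, dotProduct_sum,
        Finset.sum_eq_single α]
      · change _ ⬝ᵥ (C.D l d α β • C.basisZ l α (C.basisV l a)) = _
        rw [dotProduct_smul, dotProduct_eq, if_pos ⟨rfl, rfl⟩, smul_eq_mul, mul_one]
      · intro γ _ hγ
        change _ ⬝ᵥ (C.D l d γ β • C.basisZ l γ (C.basisV l a)) = _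
        rw [dotProduct_smul, dotProduct_eq, if_neg fun h => hγ h.2.symm, smul_zero]
      · simp
    change _ = (dimV l : ℂ) * C.D l d α β
    have h3 : ∑ a, C.basisZ l α (C.basisV l a) ⬝ᵥ zRep l d (C.basisZ l β) (C.basisV l a)
        = (dimV l : ℂ) * C.D l d α β := by
      simp only [h2]
      simp
    rw [← h3, traceForm_apply, he]
    simp only [zRep_apply, Matrix.mulVec, dotProduct, unitMatrix, Finset.sum_mul, Finset.mul_sum]
    conv_rhs => rw [Finset.sum_comm]
    refine Finset.sum_congr rfl fun i' _ => ?_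
    rw [Finset.sum_comm]
    refine Finset.sum_congr rfl fun a _ => Finset.sum_congr rfl fun i _ => ?_
    ring
  rw [← he, ← sum_dual_smul_eq b hN φ e h1]
  rfl

theorem D_Q_self (hN : 2 * k ≤ N) (l : Lam k N) (α β : Fin (dimZ l)) :
    C.D l (C.Q b l α β) = Matrix.single α β 1 := by
  have h1 : ∀ γ, zRep l (C.Q b l α β) (C.basisZ l γ) = if β = γ then C.basisZ l α else 0 := by
    intro γ
    refine Representation.IntertwiningMap.ext ((C.basisV l).ext fun a => ?_)
    change zRep l (C.Q b l α β) (C.basisZ l γ) (C.basisV l a) = _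
    rw [zRep_apply, toMat_Q C b hN, unitMatrix_mulVec]
    simp only [dotProduct_eq]
    by_cases h : β = γ
    · simp [h]
    · simp [h]
  ext γ δ
  rw [D, LinearMap.toMatrix_apply, h1, Matrix.single_apply]
  by_cases h : β = δ
  · simp [h, Finsupp.single_apply]
  · simp [h]

theorem D_Q_of_ne (hN : 2 * k ≤ N) {l l' : Lam k N} (h : l' ≠ l) (α β : Fin (dimZ l)) :
    C.D l' (C.Q b l α β) = 0 := by
  have h1 : zRep l' (C.Q b l α β) = 0 := by
    refine LinearMap.ext fun f => DFunLike.ext _ _ fun v => ?_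
    rw [zRep_apply, toMat_Q C b hN, unitMatrix_mulVec]
    refine Finset.sum_eq_zero fun a _ => ?_
    rw [Z_dotProduct_of_ne h.symm, zero_smul]
  rw [D, h1, map_zero]

/-! ### The algebra isomorphism and the relations between matrix units. -/

/-- The matrix representations `D^λ` together, as a homomorphism of algebras. -/
noncomputable def allD : PartitionAlgebra k N →ₐ[ℂ]
    ((l : Lam k N) → Matrix (Fin (dimZ l)) (Fin (dimZ l)) ℂ) :=
  AlgHom.pi fun l => (LinearMap.toMatrixAlgEquiv (C.basisZ l)).toAlgHom.comp (zRep l)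

theorem allD_apply (d : PartitionAlgebra k N) (l : Lam k N) : C.allD d l = C.D l d := rfl

theorem D_smul (l : Lam k N) (r : ℂ) (d : PartitionAlgebra k N) :
    C.D l (r • d) = r • C.D l d :=
  congrFun (map_smul C.allD r d) l

theorem D_sum {X : Type*} (l : Lam k N) (s : Finset X) (d : X → PartitionAlgebra k N) :
    C.D l (∑ x ∈ s, d x) = ∑ x ∈ s, C.D l (d x) := by
  rw [← allD_apply, map_sum, Finset.sum_apply]
  rfl

theorem D_mul (l : Lam k N) (d d' : PartitionAlgebra k N) :
    C.D l (d * d') = C.D l d * C.D l d' :=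
  congrFun (map_mul C.allD d d') l

theorem allD_injective (hN : 2 * k ≤ N) : Function.Injective C.allD := by
  rw [injective_iff_map_eq_zero]
  intro d hd
  refine eq_zero_of_zRep_eq_zero hN fun l => ?_
  have h1 : C.D l d = 0 := congrFun hd l
  exact (LinearMap.toMatrix (C.basisZ l) (C.basisZ l)).map_eq_zero_iff.1 h1

theorem allD_sum [Fintype (Lam k N)] (hN : 2 * k ≤ N)
    (M : (l : Lam k N) → Matrix (Fin (dimZ l)) (Fin (dimZ l)) ℂ) :
    C.allD (∑ l, ∑ α, ∑ β, M l α β • C.Q b l α β) = M := by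
  classical
  funext l
  simp only [allD_apply, D_sum, D_smul]
  rw [Finset.sum_eq_single l]
  · simp only [D_Q_self C b hN]
    conv_rhs => rw [Matrix.matrix_eq_sum_single (M l)]
    simp
  · intro l' _ h
    simp only [D_Q_of_ne C b hN h.symm, smul_zero, Finset.sum_const_zero]
  · simp

theorem allD_bijective (hN : 2 * k ≤ N) : Function.Bijective C.allD := by
  classical
  have := Fintype.ofFinite (Lam k N)
  have := Fintype.ofFinite (SetPart k)
  -- Any finite basis may be used to form the matrix units that hit M; the diagrams are at hand.
  exact ⟨C.allD_injective hN, fun M => ⟨_, C.allD_sum (diagBasis k N) hN M⟩⟩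

theorem linearIndependent_Q (hN : 2 * k ≤ N) : LinearIndependent ℂ
    (fun x : (Σ l : Lam k N, Fin (dimZ l) × Fin (dimZ l)) => C.Q b x.1 x.2.1 x.2.2) := by
  classical
  rw [linearIndependent_iff']
  rintro s g h ⟨l, α, β⟩ hx
  have h1 : C.D l (∑ x ∈ s, g x • C.Q b x.1 x.2.1 x.2.2) α β = C.D l 0 α β :=
    congrArg (fun d => C.D l d α β) h
  rw [← allD_apply C 0, map_zero, Pi.zero_apply, Matrix.zero_apply, D_sum, Matrix.sum_apply] at h1
  simp only [D_smul, Matrix.smul_apply] at h1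
  rw [Finset.sum_eq_single ⟨l, α, β⟩, D_Q_self C b hN, Matrix.single_apply_same, smul_eq_mul,
    mul_one] at h1
  · exact h1
  · rintro ⟨l', α', β'⟩ _ hne
    by_cases hl : l = l'
    · subst hl
      rw [D_Q_self C b hN, Matrix.single_apply, if_neg, smul_zero]
      rintro ⟨rfl, rfl⟩
      exact hne rfl
    · rw [D_Q_of_ne C b hN hl, Matrix.zero_apply, smul_zero]
  · exact fun h => absurd hx h

theorem span_Q (hN : 2 * k ≤ N) : Submodule.span ℂ (Set.range
    (fun x : (Σ l : Lam k N, Fin (dimZ l) × Fin (dimZ l)) => C.Q b x.1 x.2.1 x.2.2)) = ⊤ := by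
  classical
  have := Fintype.ofFinite (Lam k N)
  refine eq_top_iff.2 fun d _ => ?_
  rw [← C.allD_injective hN (C.allD_sum b hN (C.allD d))]
  exact Submodule.sum_mem _ fun l _ => Submodule.sum_mem _ fun α _ => Submodule.sum_mem _
    fun β _ => Submodule.smul_mem _ _ (Submodule.subset_span ⟨⟨l, α, β⟩, rfl⟩)

/-- Injectivity of `allD` reduces the identity to the product of elementary matrices. -/
theorem Q_mul_Q (hN : 2 * k ≤ N) (l : Lam k N) (α β α' β' : Fin (dimZ l)) :
    C.Q b l α β * C.Q b l α' β' = if β = α' then C.Q b l α β' else 0 := by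
  refine C.allD_injective hN (funext fun l' => ?_)
  rw [allD_apply, D_mul]
  by_cases hl : l' = l
  · subst hl
    rw [D_Q_self C b hN, D_Q_self C b hN]
    split_ifs with h
    · subst h
      rw [allD_apply, D_Q_self C b hN, Matrix.single_mul_single_same, mul_one]
    · rw [Matrix.single_mul_single_of_ne _ _ _ _ h, map_zero]
      rfl
  · rw [D_Q_of_ne C b hN hl, zero_mul]
    split_ifs
    · rw [allD_apply, D_Q_of_ne C b hN hl]
    · rw [map_zero]
      rfl

theorem Q_mul_Q_of_ne (hN : 2 * k ≤ N) {l l' : Lam k N} (h : l ≠ l') (α β : Fin (dimZ l))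
    (α' β' : Fin (dimZ l')) : C.Q b l α β * C.Q b l' α' β' = 0 := by
  refine C.allD_injective hN (funext fun m => ?_)
  rw [allD_apply, D_mul, map_zero, Pi.zero_apply]
  by_cases hm : m = l
  · subst hm
    rw [D_Q_of_ne C b hN h, mul_zero]
  · rw [D_Q_of_ne C b hN hm, zero_mul]

end ClebschGordan

end MatrixUnits

end PartAlg

theorem mainTheorem4 (k N : ℕ) (hN : 2 * k ≤ N) {ι : Type*} [Fintype ι] [DecidableEq ι]
    (b : Module.Basis ι ℂ (PartAlg.PartitionAlgebra k N)) :
    -- the trace form is non-degenerate and the `b_i^†` are the dual basis of the `b_i`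
    (PartAlg.traceForm k N).Nondegenerate ∧
    (∀ i j : ι, PartAlg.traceForm k N (b i) (PartAlg.dual b j) = if i = j then 1 else 0) ∧
    -- `Λ_{k,N}` labels nonzero representations, and real Clebsch–Gordan bases exist
    (∀ l : PartAlg.Lam k N, 0 < PartAlg.dimZ l) ∧
    Nonempty (PartAlg.ClebschGordan k N) ∧
    ∀ C : PartAlg.ClebschGordan k N,
      -- the `Q^λ_{αβ}` form a basis of `P_k(N)`
      (LinearIndependent ℂ
          (fun x : (Σ l : PartAlg.Lam k N, Fin (PartAlg.dimZ l) × Fin (PartAlg.dimZ l)) =>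
            C.Q b x.1 x.2.1 x.2.2) ∧
        Submodule.span ℂ (Set.range
          (fun x : (Σ l : PartAlg.Lam k N, Fin (PartAlg.dimZ l) × Fin (PartAlg.dimZ l)) =>
            C.Q b x.1 x.2.1 x.2.2)) = ⊤) ∧
      -- `Q^λ_{αβ} Q^{λ'}_{α'β'} = δ^{λλ'} δ_{βα'} Q^λ_{αβ'}`
      (∀ (l : PartAlg.Lam k N) (α β α' β' : Fin (PartAlg.dimZ l)),
        C.Q b l α β * C.Q b l α' β' = if β = α' then C.Q b l α β' else 0) ∧
      (∀ l l' : PartAlg.Lam k N, l ≠ l' →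
        ∀ (α β : Fin (PartAlg.dimZ l)) (α' β' : Fin (PartAlg.dimZ l')),
          C.Q b l α β * C.Q b l' α' β' = 0) ∧
      -- the Artin–Wedderburn decomposition: `d ↦ (D^λ(d))_λ` is an isomorphism of algebras onto
      -- the product of the full matrix algebras, and `Q^λ_{αβ}` goes to the elementary matrix
      (∃ Φ : PartAlg.PartitionAlgebra k N ≃ₐ[ℂ]
          ((l : PartAlg.Lam k N) → Matrix (Fin (PartAlg.dimZ l)) (Fin (PartAlg.dimZ l)) ℂ),
        (∀ (d : PartAlg.PartitionAlgebra k N) (l : PartAlg.Lam k N), Φ d l = C.D l d) ∧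
        ∀ (l : PartAlg.Lam k N) (α β : Fin (PartAlg.dimZ l)),
          Φ (C.Q b l α β) l = Matrix.single α β 1 ∧
          ∀ l' : PartAlg.Lam k N, l' ≠ l → Φ (C.Q b l α β) l' = 0) := by
  refine ⟨PartAlg.traceForm_nondegenerate hN, PartAlg.traceForm_dual b hN,
    PartAlg.dimZ_pos hN, PartAlg.nonempty_clebschGordan k N, fun C =>
    ⟨⟨C.linearIndependent_Q b hN, C.span_Q b hN⟩, C.Q_mul_Q b hN,
      fun l l' h α β α' β' => C.Q_mul_Q_of_ne b hN h α β α' β',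
      AlgEquiv.ofBijective C.allD (C.allD_bijective hN), fun d l => rfl, fun l α β =>
      ⟨C.D_Q_self b hN l α β, fun l' h => C.D_Q_of_ne b hN h α β⟩⟩⟩
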